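/- Let $F_2$ be the free group on two generators $a,b$, and let $\partial F_2$ be its boundary, i.e. the set of right-infinite reduced words in $a^{\pm1},b^{\pm1}$, with the topology whose basis consists of the cylinders (the sets of infinite reduced words with a given finite prefix). Every automorphism $\phi$ of $F_2$ induces a homeomorphism $\partial\phi$ of $\partial F_2$, where $\partial\phi(X)$ is the limit of $\phi(X_n)$ as $n\to\infty$, $X_n\in F_2$ denoting the prefix of length $n$ of $X$. One says that $\phi$ has a parabolic orbit if there are two points $X,Y\in\partial F_2$ with $X\neq Y$ such that $$\lim_{k\to+\infty}\partial\phi^k(Y)=X\quad\text{and}\quad\lim_{k\to-\infty}\partial\phi^k(Y)=X .$$ Then no automorphism of $F_2$ has a parabolic orbit. -/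

import Mathlib

open Filter Topology

namespace FreeGroup

variable {α : Type*}

/-- The boundary `∂F` of the free group `F` on the basis `α`: the set of right-infinite reduced
words. As in `FreeGroup`, a letter is a pair `(a, b)`, where `b = true` stands for the generator
`a` and `b = false` for its inverse. A word is reduced if no letter is followed by its inverse,
i.e. consecutive letters on the same generator have the same sign (cf. `FreeGroup.IsReduced`). -/
@[ext] structure Boundary (α : Type*) where
  /-- The letters of the infinite word. -/
  letter : ℕ → α × Bool
  reduced : ∀ i, (letter i).1 = (letter (i + 1)).1 → (letter i).2 = (letter (i + 1)).2

namespace Boundary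

/-- The prefix of length `n` of an infinite reduced word, as a finite word. -/
def pre (X : Boundary α) (n : ℕ) : List (α × Bool) := (List.range n).map X.letter

/-- The cylinder of a finite word `w`: the infinite reduced words that admit `w` as a prefix. -/
def cylinder (w : List (α × Bool)) : Set (Boundary α) := {X | X.pre w.length = w}

/-- The topology of `∂F`, generated by the cylinders. -/
instance : TopologicalSpace (Boundary α) :=
  TopologicalSpace.generateFrom (Set.range cylinder)

theorem pre_length (X : Boundary α) (n : ℕ) : (X.pre n).length = n := by simp [pre]

theorem pre_take (X : Boundary α) {m n : ℕ} (h : m ≤ n) : (X.pre n).take m = X.pre m := by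
  simp [pre, ← List.map_take, List.take_range, h]

theorem pre_isReduced (X : Boundary α) (n : ℕ) : IsReduced (X.pre n) := by
  unfold IsReduced
  rw [List.isChain_iff_getElem]
  intro i hi
  simpa [pre] using X.reduced i

theorem ext_pre {X Y : Boundary α} (h : ∀ n, X.pre n = Y.pre n) : X = Y := by
  ext1
  funext i
  have := congrArg (fun l => l[i]?) (h (i + 1))
  simpa [pre] using this

end Boundary

section

variable [DecidableEq α]

/-- Convergence of a sequence of elements of `F` to a point `X` of the boundary, in the
compactification `F ∪ ∂F`: every finite prefix of `X` is eventually a prefix of `g n`. -/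
def TendstoBoundary (g : ℕ → FreeGroup α) (X : Boundary α) : Prop :=
  ∀ m, ∀ᶠ n in atTop, (g n).toWord.take m = X.pre m

theorem TendstoBoundary.unique {g : ℕ → FreeGroup α} {X Y : Boundary α}
    (hX : TendstoBoundary g X) (hY : TendstoBoundary g Y) : X = Y :=
  Boundary.ext_pre fun m => by
    obtain ⟨n, h1, h2⟩ := ((hX m).and (hY m)).exists
    rw [← h1, ← h2]

theorem mk_pre_toWord (X : Boundary α) (n : ℕ) : (mk (X.pre n)).toWord = X.pre n := by
  rw [toWord_mk, (X.pre_isReduced n).reduce_eq]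

theorem tendstoBoundary_pre (X : Boundary α) : TendstoBoundary (fun n => mk (X.pre n)) X := by
  intro m
  filter_upwards [eventually_ge_atTop m] with n hn
  rw [mk_pre_toWord, X.pre_take hn]

/-- Right multiplication by a letter changes at most the last letter of a reduced word. -/
theorem take_toWord_mul_letter (g : FreeGroup α) (c : α × Bool) {m : ℕ}
    (hm : m + 1 ≤ g.norm) : (g * mk [c]).toWord.take m = g.toWord.take m := by
  have hg : g * mk [c] = mk (g.toWord ++ [c]) := by rw [← mul_mk, mk_toWord]
  have hred : IsReduced g.toWord := isReduced_toWord
  unfold norm at hm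
  rw [hg, toWord_mk]
  generalize g.toWord = w at *
  rcases List.eq_nil_or_concat w with rfl | ⟨v, d, rfl⟩
  · simp at hm
  rw [List.concat_eq_append] at *
  simp only [List.length_append, List.length_singleton] at hm
  by_cases hdc : d.1 = c.1 → d.2 = c.2
  · have : IsReduced (v ++ [d] ++ [c]) :=
      IsReduced.append_overlap hred (by simpa using hdc) (by simp)
    rw [this.reduce_eq, List.take_append_of_le_length (by simp; omega)]
  · push Not at hdc
    have hc : c = (d.1, !d.2) := by
      obtain ⟨h1, h2⟩ := hdc
      ext
      · exact h1.symm
      · revert h2; cases d.2 <;> cases c.2 <;> simp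
    have hv : IsReduced v := hred.infix ⟨[], [d], by simp⟩
    have h3 : Red.Step (v ++ [d] ++ [c]) v := by
      have := @Red.Step.not α v [] d.1 d.2
      simpa [hc] using this
    rw [reduce.Step.eq h3, hv.reduce_eq, List.take_append_of_le_length (by omega)]

theorem take_toWord_mul (g : FreeGroup α) (w : List (α × Bool)) {m : ℕ}
    (hm : m + w.length ≤ g.norm) : (g * mk w).toWord.take m = g.toWord.take m := by
  induction w generalizing g m with
  | nil => rw [← one_eq_mk, mul_one]
  | cons c w ih =>
    simp only [List.length_cons] at hm
    have hcw : g * mk (c :: w) = (g * mk [c]) * mk w := by rw [mul_assoc, mul_mk]; rfl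
    have h1 : g.norm ≤ (g * mk [c]).norm + 1 := by
      calc g.norm = ((g * mk [c]) * (mk [c])⁻¹).norm := by rw [mul_inv_cancel_right]
        _ ≤ (g * mk [c]).norm + (mk [c])⁻¹.norm := norm_mul_le _ _
        _ ≤ _ := by rw [norm_inv_eq]; exact Nat.add_le_add_left norm_mk_le _
    rw [hcw, ih _ (by omega), take_toWord_mul_letter _ _ (by omega)]

/-- Endomorphisms of a free group of finite rank are Lipschitz for the word metric. -/
theorem exists_norm_map_le [Finite α] (f : FreeGroup α →* FreeGroup α) :
    ∃ C, ∀ g, (f g).norm ≤ C * g.norm := by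
  obtain ⟨C, hC⟩ := (Set.finite_range fun c : α × Bool => (f (mk [c])).norm).bddAbove
  refine ⟨C, fun g => ?_⟩
  have key : ∀ w : List (α × Bool), (f (mk w)).norm ≤ C * w.length := by
    intro w
    induction w with
    | nil => simp [← one_eq_mk]
    | cons c w ih =>
      have : mk (c :: w) = mk [c] * mk w := by rw [mul_mk]; rfl
      rw [this, _root_.map_mul, List.length_cons, mul_add, mul_one, add_comm]
      exact (norm_mul_le _ _).trans (Nat.add_le_add (hC ⟨c, rfl⟩) ih)
  simpa [mk_toWord, norm] using key g.toWord

/-- The prefix of length `m` of `φ g` depends only on a prefix of `g` whose length depends only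
on `m` and `φ`. -/
theorem exists_modulus [Finite α] (φ : FreeGroup α ≃* FreeGroup α) :
    ∃ K : ℕ → ℕ, Monotone K ∧ ∀ m (w : List (α × Bool)), IsReduced w → K m ≤ w.length →
      m ≤ (φ (mk w)).norm ∧
      (φ (mk w)).toWord.take m = (φ (mk (w.take (K m)))).toWord.take m := by
  obtain ⟨C, hC⟩ := exists_norm_map_le φ.toMonoidHom
  obtain ⟨D, hD⟩ := exists_norm_map_le φ.symm.toMonoidHom
  have hlow : ∀ m (w : List (α × Bool)), IsReduced w → (D + 1) * (m + C) ≤ w.length →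
      m + C ≤ (φ (mk w)).norm := by
    intro m w hw hk
    have h1 := hD (φ (mk w))
    have h2 : (φ.symm.toMonoidHom (φ (mk w))).norm = w.length := by
      simp [norm, toWord_mk, hw.reduce_eq]
    rw [h2] at h1
    by_contra! hlt
    have h3 : (D + 1) * (φ (mk w)).norm < (D + 1) * (m + C) :=
      Nat.mul_lt_mul_of_pos_left hlt (by omega)
    nlinarith
  refine ⟨fun m => (D + 1) * (m + C), ?_, fun m w hw hk => ⟨?_, ?_⟩⟩
  · intro a b hab
    exact Nat.mul_le_mul_left _ (by omega)
  · have := hlow m w hw hk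
    omega
  · induction w using List.reverseRecOn with
    | nil => simp
    | append_singleton v c ih =>
      beta_reduce at hk ih ⊢
      rcases Nat.lt_or_ge v.length ((D + 1) * (m + C)) with hlt | hge
      · rw [List.take_of_length_le (l := v ++ [c])]
        simp only [List.length_append, List.length_singleton]
        omega
      · have hv : IsReduced v := hw.infix ⟨[], [c], by simp⟩
        rw [List.take_append_of_le_length hge, ← ih hv hge, ← mul_mk, _root_.map_mul,
          ← mk_toWord (x := φ (mk [c])), take_toWord_mul]
        have h1 := hlow m v hv hge
        have h2 := hC (mk [c])
        have h3 : (mk [c]).norm ≤ 1 := norm_mk_le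
        have h4 : C * (mk [c]).norm ≤ C * 1 := Nat.mul_le_mul_left _ h3
        have h5 : (φ (mk [c])).toWord.length = (φ.toMonoidHom (mk [c])).norm := rfl
        omega

/-- If `g n` tends to the boundary point `X`, then `φ (g n)` tends to a boundary point that
depends only on `X`, locally uniformly in `X`. -/
theorem exists_boundary_image [Finite α] (φ : FreeGroup α ≃* FreeGroup α) :
    ∃ (K : ℕ → ℕ) (f : Boundary α → Boundary α), ∀ X m,
      ∀ w : List (α × Bool), IsReduced w → w.take (K m) = X.pre (K m) →
        (φ (mk w)).toWord.take m = (f X).pre m := by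
  obtain ⟨K, hmono, hK⟩ := exists_modulus φ
  refine ⟨K, ?_⟩
  suffices h : ∀ X : Boundary α, ∃ Z : Boundary α, ∀ m,
      (φ (mk (X.pre (K m)))).toWord.take m = Z.pre m by
    choose f hf using h
    refine ⟨f, fun X m w hw hwX => ?_⟩
    have hlen : K m ≤ w.length := by
      have := congrArg List.length hwX
      rw [X.pre_length, List.length_take] at this
      omega
    rw [(hK m w hw hlen).2, hwX, hf]
  intro X
  have hlen : ∀ m, m ≤ (φ (mk (X.pre (K m)))).toWord.length := fun m =>
    (hK m _ (X.pre_isReduced _) (by rw [X.pre_length])).1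
  have hcomp : ∀ m n, m ≤ n → (φ (mk (X.pre (K n)))).toWord.take m =
      (φ (mk (X.pre (K m)))).toWord.take m := by
    intro m n hmn
    rw [(hK m _ (X.pre_isReduced (K n)) (by rw [X.pre_length]; exact hmono hmn)).2,
      X.pre_take (hmono hmn)]
  have hget : ∀ i n (h : i < n), (φ (mk (X.pre (K n)))).toWord[i]'(by
        have := hlen n; omega) =
      (φ (mk (X.pre (K (i + 1))))).toWord[i]'(by have := hlen (i + 1); omega) := by
    intro i n h
    have h1 := congrArg (fun l => l[i]?) (hcomp (i + 1) n h)
    simp only [List.getElem?_take, Nat.lt_succ_self, if_true] at h1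
    rw [List.getElem?_eq_getElem (by have := hlen n; omega),
      List.getElem?_eq_getElem (by have := hlen (i + 1); omega)] at h1
    exact Option.some.inj h1
  refine ⟨⟨fun i => (φ (mk (X.pre (K (i + 1))))).toWord[i]'(by
    have := hlen (i + 1); omega), ?_⟩, ?_⟩
  · intro i
    have hred : IsReduced (φ (mk (X.pre (K (i + 2))))).toWord := isReduced_toWord
    unfold IsReduced at hred
    rw [List.isChain_iff_getElem] at hred
    have h1 := hred i (by have := hlen (i + 2); omega)
    rw [hget i (i + 2) (by omega)] at h1
    exact h1
  · intro m
    apply List.ext_getElem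
    · rw [Boundary.pre_length, List.length_take]
      have := hlen m
      omega
    · intro i h1 h2
      rw [Boundary.pre_length] at h2
      simp only [List.getElem_take, Boundary.pre, List.getElem_map, List.getElem_range]
      exact hget i m h2

theorem exists_tendstoBoundary [Finite α] (φ : FreeGroup α ≃* FreeGroup α) (X : Boundary α) :
    ∃ Z, TendstoBoundary (fun n => φ (mk (X.pre n))) Z := by
  obtain ⟨K, f, h⟩ := exists_boundary_image φ
  refine ⟨f X, fun m => ?_⟩
  filter_upwards [eventually_ge_atTop (K m)] with n hn
  exact h X m _ (X.pre_isReduced n) (X.pre_take hn)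

/-- The map `∂φ : ∂F → ∂F` induced by an automorphism `φ` of `F`: the image of `X` is the limit
of the images under `φ` of the finite prefixes of `X`. -/
noncomputable def boundaryMap [Finite α] (φ : FreeGroup α ≃* FreeGroup α)
    (X : Boundary α) : Boundary α := (exists_tendstoBoundary φ X).choose

theorem boundaryMap_spec [Finite α] (φ : FreeGroup α ≃* FreeGroup α) (X : Boundary α) :
    TendstoBoundary (fun n => φ (mk (X.pre n))) (boundaryMap φ X) :=
  (exists_tendstoBoundary φ X).choose_spec

theorem exists_modulus_boundaryMap [Finite α] (φ : FreeGroup α ≃* FreeGroup α) :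
    ∃ K : ℕ → ℕ, ∀ X m, ∀ w : List (α × Bool), IsReduced w → w.take (K m) = X.pre (K m) →
      (φ (mk w)).toWord.take m = (boundaryMap φ X).pre m := by
  obtain ⟨K, f, h⟩ := exists_boundary_image φ
  refine ⟨K, fun X m w hw hwX => ?_⟩
  have : boundaryMap φ X = f X := by
    refine (boundaryMap_spec φ X).unique fun m => ?_
    filter_upwards [eventually_ge_atTop (K m)] with n hn
    exact h X m _ (X.pre_isReduced n) (X.pre_take hn)
  rw [this]
  exact h X m w hw hwX

/-- `φ` and `∂φ` together are sequentially continuous at the points of the boundary. -/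
theorem TendstoBoundary.map [Finite α] (φ : FreeGroup α ≃* FreeGroup α)
    {g : ℕ → FreeGroup α} {X : Boundary α} (h : TendstoBoundary g X) :
    TendstoBoundary (fun n => φ (g n)) (boundaryMap φ X) := by
  obtain ⟨K, hK⟩ := exists_modulus_boundaryMap φ
  intro m
  filter_upwards [h (K m)] with n hn
  rw [← hK X m _ isReduced_toWord hn, mk_toWord]

theorem boundaryMap_symm_apply [Finite α] (φ : FreeGroup α ≃* FreeGroup α) (X : Boundary α) :
    boundaryMap φ.symm (boundaryMap φ X) = X := by
  have h := (boundaryMap_spec φ X).map φ.symm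
  simp only [MulEquiv.symm_apply_apply] at h
  exact h.unique (tendstoBoundary_pre X)

theorem continuous_boundaryMap [Finite α] (φ : FreeGroup α ≃* FreeGroup α) :
    Continuous (boundaryMap φ) := by
  obtain ⟨K, hK⟩ := exists_modulus_boundaryMap φ
  refine continuous_generateFrom_iff.2 ?_
  rintro _ ⟨w, rfl⟩
  rw [isOpen_iff_forall_mem_open]
  intro X hX
  refine ⟨Boundary.cylinder (X.pre (K w.length)), fun Y hY => ?_,
    TopologicalSpace.isOpen_generateFrom_of_mem ⟨_, rfl⟩, ?_⟩
  · simp only [Boundary.cylinder, Boundary.pre_length, Set.mem_ofPred_eq, Set.mem_preimage] at *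
    rw [← hK Y w.length _ (Y.pre_isReduced (K w.length)) (Y.pre_take le_rfl),
      hK X w.length _ (Y.pre_isReduced (K w.length)) (by rw [Y.pre_take le_rfl, hY]), hX]
  · simp [Boundary.cylinder, Boundary.pre_length]

/-- The homeomorphism `∂φ` of `∂F` induced by an automorphism `φ` of `F`. -/
noncomputable def boundaryHomeomorph [Finite α] (φ : FreeGroup α ≃* FreeGroup α) :
    Boundary α ≃ₜ Boundary α where
  toFun := boundaryMap φ
  invFun := boundaryMap φ.symm
  left_inv := boundaryMap_symm_apply φ
  right_inv X := boundaryMap_symm_apply φ.symm X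
  continuous_toFun := continuous_boundaryMap φ
  continuous_invFun := continuous_boundaryMap φ.symm

/-- An automorphism `φ` of `F` has a parabolic orbit if there are two distinct points `X`, `Y`
of `∂F` such that `∂φ ^ k (Y)` tends to `X` both for `k → +∞` and for `k → -∞`. Here
`∂φ ^ k`, for an integer `k`, is the power in the group of homeomorphisms of `∂F`. -/
def HasParabolicOrbit [Finite α] (φ : FreeGroup α ≃* FreeGroup α) : Prop :=
  ∃ X Y : Boundary α, X ≠ Y ∧
    Tendsto (fun k : ℤ => (boundaryHomeomorph φ ^ k) Y) atTop (𝓝 X) ∧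
    Tendsto (fun k : ℤ => (boundaryHomeomorph φ ^ k) Y) atBot (𝓝 X)

end

end FreeGroup

/-!
Let `ψ = φ ^ 2` and suppose that the orbit `Y_k` of `Y` under `∂ψ` tends to `X` for `k → ±∞`. By
continuity `X` is a fixed point of `∂ψ`. There are two cases.

If `ψ` fixes no element of `F_2` except `1`, then `X` is attracting or repelling
(`isAttracting_or_isAttracting_symm`, valid in every finite rank): with `X_n` the prefixes of `X`,
the elements `X_n⁻¹ ψ(X_n)` are pairwise distinct, so their lengths tend to infinity, and by bounded
cancellation (`exists_bounded_cancellation`) `ψ(X_n)` is up to a bounded error a prefix of `X`,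
which is therefore much longer than `X_n` for all large `n`, or much shorter for all large `n`. The
inverse is treated in the same way, and one of `ψ`, `ψ⁻¹` moves the small cylinders around `X` into
smaller ones. An orbit that emanates from an attracting fixed point is constant, so `Y = X`.

If `ψ` fixes `w ≠ 1`, then the limits of `w ^ n` and of `w ^ (-n)` are two fixed points of `∂ψ`, so
there is a fixed point `Z ≠ X`. Here rank two enters: `F_2` is the fundamental group of a
once-punctured torus, all of whose automorphisms come from homeomorphisms, so that they preserve or
reverse the cyclic order of the boundary (`preservesCyc_or_reversesCyc`), and the square `ψ`
preserves it. Cutting the cycle at `X` gives an invariant linear order on the other points, in which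
the orbit is monotone and stays on one side of `Z`. In one of the two time directions it moves
towards `Z`, and it cannot tend to `X` in that direction.

The cyclic order of three boundary points is read off at their median in the Cayley tree, from the
cyclic order `a, b, a⁻¹, b⁻¹` of the edges there. Its invariance is checked on signed permutations
of the generators, on the transvection `a ↦ a b` and on inner automorphisms. That these generate
is Nielsen's theorem, proved by shortening the basis `φ a, φ b`: in a shortest basis no factor of
a product is cancelled entirely by its neighbours, so lengths do not decrease under `φ`, and the
preimages of `a` and `b` are letters. The only case in which transvections alone do not shorten is
that `u v u` cancels all of `v`, one half on either side; then a conjugation helps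
(`exists_conj_norm_lt`). Cancellation is measured by the Gromov product of the tree.
-/

/-! ### Common prefixes and the Gromov product -/

/-- The length of the longest common prefix of two lists. -/
def List.lcpLength {β : Type*} [DecidableEq β] : List β → List β → ℕ
  | a :: l, b :: m => if a = b then List.lcpLength l m + 1 else 0
  | [], _ => 0
  | _ :: _, [] => 0

theorem List.le_lcpLength_iff {β : Type*} [DecidableEq β] (l m : List β) (k : ℕ) :
    k ≤ l.lcpLength m ↔ k ≤ l.length ∧ k ≤ m.length ∧ l.take k = m.take k := by
  induction l generalizing m k with
  | nil => cases m <;> simp +contextual [List.lcpLength]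
  | cons a l ih =>
    cases m with
    | nil => simp +contextual [List.lcpLength]
    | cons b m =>
      cases k with
      | zero => simp
      | succ k =>
        by_cases h : a = b
        · simp [List.lcpLength, h, ih]
        · simp [List.lcpLength, h]

namespace FreeGroup

section

variable {α : Type*}

/-- The inverse of a letter. -/
def invLetter (c : α × Bool) : α × Bool := (c.1, !c.2)

@[simp] theorem invLetter_invLetter (c : α × Bool) : invLetter (invLetter c) = c := by
  simp [invLetter]

theorem ne_invLetter_iff {c d : α × Bool} : d ≠ invLetter c ↔ (c.1 = d.1 → c.2 = d.2) := by
  obtain ⟨c, s⟩ := c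
  obtain ⟨d, t⟩ := d
  cases s <;> cases t <;> simp [invLetter, eq_comm]

theorem mk_invLetter (c : α × Bool) : mk [invLetter c] = (mk [c])⁻¹ := by
  simp [invLetter, inv_mk, invRev]

theorem isReduced_append {u w : List (α × Bool)} (hu : IsReduced u) (hw : IsReduced w)
    (h : ∀ c ∈ u.getLast?, ∀ d ∈ w.head?, d ≠ invLetter c) : IsReduced (u ++ w) :=
  List.isChain_append.2 ⟨hu, hw, fun c hc d hd => ne_invLetter_iff.1 (h c hc d hd)⟩

theorem isReduced_invRev {w : List (α × Bool)} (hw : IsReduced w) :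
    IsReduced (invRev w) := by
  classical
  rw [isReduced_iff_reduce_eq] at *
  rw [reduce_invRev, hw]

theorem getLast?_invRev (w : List (α × Bool)) :
    (invRev w).getLast? = w.head?.map invLetter := by
  cases w <;> simp [invRev, invLetter]

theorem head?_invRev (w : List (α × Bool)) :
    (invRev w).head? = w.getLast?.map invLetter := by
  simp [invRev]
  rfl

variable [DecidableEq α]

theorem IsReduced.norm_mk {w : List (α × Bool)} (hw : IsReduced w) : (mk w).norm = w.length := by
  rw [norm, toWord_mk, hw.reduce_eq]

theorem norm_inv_mk_mul_mk {u w : List (α × Bool)} (hu : IsReduced u) (hw : IsReduced w) :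
    ((mk u)⁻¹ * mk w).norm + 2 * u.lcpLength w = u.length + w.length := by
  induction u generalizing w with
  | nil => simp [← one_eq_mk, List.lcpLength, hw.norm_mk]
  | cons c u ih =>
    cases w with
    | nil =>
      rw [← one_eq_mk, mul_one, norm_inv_eq, hu.norm_mk]
      simp [List.lcpLength]
    | cons d w =>
      by_cases h : c = d
      · subst h
        have := ih (w := w) (hu.infix ⟨[c], [], by simp⟩) (hw.infix ⟨[c], [], by simp⟩)
        have h2 : (mk (c :: u))⁻¹ * mk (c :: w) = (mk u)⁻¹ * mk w := by
          have h3 : ∀ v, mk (c :: v) = mk [c] * mk v := fun v => by rw [mul_mk]; rfl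
          rw [h3 u, h3 w]
          group
        rw [h2, List.lcpLength, if_pos rfl, List.length_cons, List.length_cons]
        omega
      · rw [inv_mk, mul_mk, IsReduced.norm_mk, List.lcpLength, if_neg h]
        · simp
        · refine isReduced_append (isReduced_invRev hu) hw ?_
          rw [getLast?_invRev]
          simpa using Ne.symm h

/-- The Gromov product of two elements of a free group with respect to `1`, in the Cayley tree:
the length of the longest common prefix of their reduced words. -/
def gromovProduct (g h : FreeGroup α) : ℕ := g.toWord.lcpLength h.toWord

theorem le_gromovProduct_iff {g h : FreeGroup α} {k : ℕ} : k ≤ gromovProduct g h ↔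
    k ≤ g.norm ∧ k ≤ h.norm ∧ g.toWord.take k = h.toWord.take k :=
  List.le_lcpLength_iff _ _ _

theorem norm_inv_mul_add (g h : FreeGroup α) :
    (g⁻¹ * h).norm + 2 * gromovProduct g h = g.norm + h.norm := by
  have := norm_inv_mk_mul_mk (isReduced_toWord (x := g)) (isReduced_toWord (x := h))
  rwa [mk_toWord, mk_toWord] at this

theorem norm_mul_add (g h : FreeGroup α) :
    (g * h).norm + 2 * gromovProduct g⁻¹ h = g.norm + h.norm := by
  simpa using norm_inv_mul_add g⁻¹ h

theorem gromovProduct_comm (g h : FreeGroup α) : gromovProduct g h = gromovProduct h g := by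
  have h1 := norm_inv_mul_add g h
  have h2 := norm_inv_mul_add h g
  have h3 : (g⁻¹ * h).norm = (h⁻¹ * g).norm := by rw [← norm_inv_eq]; simp
  omega

/-- The Cayley tree is `0`-hyperbolic. -/
theorem min_gromovProduct_le (g h k : FreeGroup α) :
    min (gromovProduct g h) (gromovProduct h k) ≤ gromovProduct g k := by
  have h1 := le_gromovProduct_iff.1 (min_le_left (gromovProduct g h) (gromovProduct h k))
  have h2 := le_gromovProduct_iff.1 (min_le_right (gromovProduct g h) (gromovProduct h k))
  exact le_gromovProduct_iff.2 ⟨h1.1, h2.2.1, h1.2.2.trans h2.2.2⟩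

theorem gromovProduct_eq_of_lt {g h k : FreeGroup α}
    (hlt : gromovProduct h k < gromovProduct g h) : gromovProduct g k = gromovProduct h k := by
  have h1 := min_gromovProduct_le g h k
  have h2 := min_gromovProduct_le h g k
  rw [gromovProduct_comm h g] at h2
  omega

/-- A nontrivial element of a free group acts on the Cayley tree without fixed points or
inversions, so its square is longer. -/
theorem norm_lt_norm_sq {g : FreeGroup α} (hg : g ≠ 1) : g.norm < (g * g).norm := by
  have h1 := congrArg List.length (reduceCyclically.conj_conjugator_reduceCyclically g.toWord)
  have h2 := congrArg List.length
    (reduceCyclically.reduce_flatten_replicate_succ (isReduced_toWord (x := g)) 1)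
  have h3 := congrArg List.length (toWord_pow g 2)
  rw [h2, pow_two] at h3
  simp only [List.length_append, invRev_length, List.length_flatten, List.map_replicate,
    List.sum_replicate, smul_eq_mul] at h1 h3
  have h4 : (reduceCyclically g.toWord).length ≠ 0 := by
    intro h0
    have h5 := reduceCyclically.conj_conjugator_reduceCyclically g.toWord
    rw [List.length_eq_zero_iff.1 h0] at h5
    have h6 := congrArg mk h5
    rw [List.append_nil, ← mul_mk, ← inv_mk, mul_inv_cancel, mk_toWord] at h6
    exact hg h6.symm
  unfold norm
  omega

theorem two_mul_gromovProduct_inv_lt {g : FreeGroup α} (hg : g ≠ 1) :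
    2 * gromovProduct g⁻¹ g < g.norm := by
  have h1 := norm_mul_add g g
  have h2 := norm_lt_norm_sq hg
  omega

end

section

variable {α : Type*}

/-! ### The action of the free group on its boundary, and directions in the Cayley tree -/

theorem Boundary.pre_getElem? (X : Boundary α) {i n : ℕ} (h : i < n) :
    (X.pre n)[i]? = some (X.letter i) := by
  simp [Boundary.pre, h]

theorem Boundary.letter_eq_of_pre_eq {X Y : Boundary α} {i n : ℕ} (h : X.pre n = Y.pre n)
    (hi : i < n) : X.letter i = Y.letter i := by
  have := congrArg (fun l => l[i]?) h
  simpa [Boundary.pre_getElem?, hi] using this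

theorem Boundary.pre_eq_of_letter_eq {X Y : Boundary α} {n : ℕ}
    (h : ∀ i < n, X.letter i = Y.letter i) : X.pre n = Y.pre n := by
  refine List.map_congr_left fun i hi => h i (List.mem_range.1 hi)

theorem Boundary.letter_succ_ne (X : Boundary α) (i : ℕ) :
    X.letter (i + 1) ≠ invLetter (X.letter i) := ne_invLetter_iff.2 (X.reduced i)

theorem Boundary.eventually_pre_eq {ι : Type*} {l : Filter ι} {y : ι → Boundary α}
    {X : Boundary α} (h : Tendsto y l (𝓝 X)) (m : ℕ) : ∀ᶠ k in l, (y k).pre m = X.pre m := by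
  have h1 : IsOpen (Boundary.cylinder (X.pre m)) :=
    TopologicalSpace.isOpen_generateFrom_of_mem ⟨_, rfl⟩
  have h2 := h (h1.mem_nhds (by simp [Boundary.cylinder, Boundary.pre_length]))
  filter_upwards [h2] with k hk
  simpa [Boundary.cylinder, Boundary.pre_length] using hk

variable [DecidableEq α]

theorem TendstoBoundary.eventually_head? {g : ℕ → FreeGroup α} {X : Boundary α}
    (h : TendstoBoundary g X) : ∀ᶠ n in atTop, (g n).toWord.head? = some (X.letter 0) := by
  filter_upwards [h 1] with n hn
  have := congrArg List.head? hn
  rw [List.head?_take] at this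
  simpa [Boundary.pre] using this

theorem TendstoBoundary.mul_const {g : ℕ → FreeGroup α} {X : Boundary α}
    (h : TendstoBoundary g X) (c : FreeGroup α) : TendstoBoundary (fun n => g n * c) X := by
  intro m
  filter_upwards [h (m + c.norm)] with n hn
  have h1 := congrArg List.length hn
  rw [X.pre_length, List.length_take] at h1
  have h2 := take_toWord_mul (g n) c.toWord (m := m) (by unfold norm at *; omega)
  rw [mk_toWord] at h2
  rw [h2, ← X.pre_take (Nat.le_add_right m c.norm), ← hn, List.take_take,
    min_eq_left (Nat.le_add_right m c.norm)]

variable [Finite α]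

theorem boundaryMap_mul (φ ψ : MulAut (FreeGroup α)) (X : Boundary α) :
    boundaryMap (φ * ψ) X = boundaryMap φ (boundaryMap ψ X) :=
  (boundaryMap_spec (φ * ψ) X).unique ((boundaryMap_spec ψ X).map φ)

theorem boundaryMap_apply_symm (φ : FreeGroup α ≃* FreeGroup α) (X : Boundary α) :
    boundaryMap φ (boundaryMap φ.symm X) = X := boundaryMap_symm_apply φ.symm X

theorem boundaryMap_injective (φ : FreeGroup α ≃* FreeGroup α) :
    Function.Injective (boundaryMap φ) :=
  Function.LeftInverse.injective (boundaryMap_symm_apply φ)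

/-- The action of the free group on its boundary by left multiplication. It is encoded as the
boundary map of an inner automorphism, which differs from left multiplication by a right factor
that is not seen in the limit. -/
noncomputable def translate (g : FreeGroup α) (X : Boundary α) : Boundary α :=
  boundaryMap (MulAut.conj g) X

theorem TendstoBoundary.translate {s : ℕ → FreeGroup α} {X : Boundary α}
    (h : TendstoBoundary s X) (g : FreeGroup α) :
    TendstoBoundary (fun n => g * s n) (translate g X) := by
  have := (h.map (MulAut.conj g)).mul_const g
  simpa [FreeGroup.translate] using this

theorem translate_mul (g h : FreeGroup α) (X : Boundary α) :
    translate (g * h) X = translate g (translate h X) := by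
  unfold translate
  rw [_root_.map_mul, boundaryMap_mul]

theorem boundaryMap_translate (φ : MulAut (FreeGroup α)) (g : FreeGroup α)
    (X : Boundary α) :
    boundaryMap φ (translate g X) = translate (φ g) (boundaryMap φ X) := by
  unfold translate
  rw [← boundaryMap_mul, ← boundaryMap_mul]
  congr 1
  ext x
  simp

/-- The direction at the vertex `g` of the Cayley tree in which one leaves towards `X`: the first
letter of `g⁻¹ X`. -/
noncomputable def dir (g : FreeGroup α) (X : Boundary α) : α × Bool :=
  (translate g⁻¹ X).letter 0

theorem dir_translate (g h : FreeGroup α) (X : Boundary α) :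
    dir g (translate h X) = dir (h⁻¹ * g) X := by
  simp [dir, ← translate_mul]

theorem dir_one (X : Boundary α) : dir 1 X = X.letter 0 := by
  have h1 := (tendstoBoundary_pre X).translate (1 : FreeGroup α)⁻¹
  simp only [inv_one, one_mul] at h1
  rw [dir, inv_one, h1.unique (tendstoBoundary_pre X)]

theorem dir_inv_mk_of_ne {u : List (α × Bool)} (hu : IsReduced u) {c d : α × Bool}
    (hc : u.head? = some c) (hd : u.getLast? = some d) {X : Boundary α}
    (hX : X.letter 0 ≠ invLetter d) : dir (mk u)⁻¹ X = c := by
  have h := ((tendstoBoundary_pre X).translate (mk u)).eventually_head?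
  obtain ⟨n, hn, hn0⟩ := (h.and (eventually_ge_atTop 1)).exists
  have h1 : IsReduced (u ++ X.pre n) := by
    refine isReduced_append hu (X.pre_isReduced n) fun a ha b hb => ?_
    have h2 : (X.pre n).head? = some (X.letter 0) := by
      rw [List.head?_eq_getElem?, X.pre_getElem? (by omega)]
    rw [h2] at hb
    simp only [hd, Option.mem_def, Option.some.injEq] at ha hb
    subst ha hb
    exact hX
  rw [mul_mk, toWord_mk, h1.reduce_eq, List.head?_append, hc] at hn
  simpa [dir] using hn.symm

/-- Of two vertices `g` and `h`, each boundary point is seen from `g` in the direction of `h`, or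
from `h` in the direction of `g`: here `c` is the first edge of the path from `g` to `h`, and `d`
that of the path from `h` to `g`. -/
theorem exists_dir_eq_or {g h : FreeGroup α} (hgh : g ≠ h) :
    ∃ c d : α × Bool, ∀ X : Boundary α, dir g X = c ∨ dir h X = d := by
  have hw : (g⁻¹ * h).toWord ≠ [] := by
    rw [Ne, toWord_eq_nil_iff, inv_mul_eq_one]
    exact hgh
  obtain ⟨c, hc⟩ := Option.ne_none_iff_exists'.1 (mt List.head?_eq_none_iff.1 hw)
  obtain ⟨d, hd⟩ := Option.ne_none_iff_exists'.1 (mt List.getLast?_eq_none_iff.1 hw)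
  refine ⟨c, invLetter d, fun X => or_iff_not_imp_right.2 fun hX => ?_⟩
  have h1 := dir_inv_mk_of_ne isReduced_toWord hc hd (X := translate h⁻¹ X) hX
  rw [mk_toWord, dir_translate] at h1
  simpa using h1

theorem dir_mk_pre (X : Boundary α) (n : ℕ) : dir (mk (X.pre n)) X = X.letter n := by
  have h := ((tendstoBoundary_pre X).translate (mk (X.pre n))⁻¹).eventually_head?
  obtain ⟨k, hk, hn⟩ := (h.and (eventually_gt_atTop n)).exists
  have h1 : X.pre k = X.pre n ++ (X.pre k).drop n := by
    rw [← X.pre_take hn.le, List.take_append_drop]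
  have h2 : IsReduced ((X.pre k).drop n) :=
    (X.pre_isReduced k).infix (List.drop_suffix _ _).isInfix
  rw [h1, ← mul_mk, inv_mul_cancel_left, toWord_mk, h2.reduce_eq, List.head?_drop,
    X.pre_getElem? hn] at hk
  exact (Option.some.inj hk).symm

theorem dir_mk_pre_of_lt {X Y : Boundary α} {i n : ℕ} (hin : i < n) (hpre : X.pre i = Y.pre i)
    (hne : X.letter i ≠ Y.letter i) :
    dir (mk (X.pre n)) Y = invLetter (X.letter (n - 1)) := by
  set u := (X.pre n).drop i with hu
  have h1 : X.pre n = X.pre i ++ u := by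
    rw [hu, ← X.pre_take hin.le, List.take_append_drop]
  have h2 : IsReduced u := (X.pre_isReduced n).infix (List.drop_suffix _ _).isInfix
  have h3 : u.head? = some (X.letter i) := by
    rw [hu, List.head?_drop, X.pre_getElem? hin]
  have h4 : u.getLast? = some (X.letter (n - 1)) := by
    rw [List.getLast?_eq_getElem?, hu, List.getElem?_drop, List.length_drop, X.pre_length,
      show i + (n - i - 1) = n - 1 by omega, X.pre_getElem? (by omega)]
  have h5 := dir_inv_mk_of_ne (isReduced_invRev h2) (c := invLetter (X.letter (n - 1)))
    (d := invLetter (X.letter i)) (X := translate (mk (X.pre i))⁻¹ Y)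
    (by rw [head?_invRev, h4]; rfl) (by rw [getLast?_invRev, h3]; rfl) (by
      rw [invLetter_invLetter, hpre]
      exact fun h => hne (h.symm.trans (dir_mk_pre Y i)))
  rw [dir_translate, inv_inv, ← inv_mk, inv_inv, mul_mk, ← h1] at h5
  exact h5

theorem isOpen_dir_eq (g : FreeGroup α) (c : α × Bool) : IsOpen {X : Boundary α | dir g X = c} := by
  have h1 : IsOpen (Boundary.cylinder [c] : Set (Boundary α)) :=
    TopologicalSpace.isOpen_generateFrom_of_mem ⟨_, rfl⟩
  have h2 := h1.preimage (continuous_boundaryMap (MulAut.conj g⁻¹))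
  convert h2 using 1
  ext X
  simp [Boundary.cylinder, Boundary.pre, dir, translate]

/-- Three distinct boundary points leave some vertex of the tree, their median, in three different
directions. -/
theorem exists_dir_ne {X Y Z : Boundary α} (hXY : X ≠ Y) (hXZ : X ≠ Z) (hYZ : Y ≠ Z) :
    ∃ g, dir g X ≠ dir g Y ∧ dir g X ≠ dir g Z ∧ dir g Y ≠ dir g Z := by
  -- `i` is the length of the common prefix
  have hsplit : ∀ {X Y : Boundary α}, X ≠ Y → ∃ i, X.pre i = Y.pre i ∧
      X.letter i ≠ Y.letter i := by
    intro X Y h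
    have h1 : ∃ i, X.letter i ≠ Y.letter i := by
      by_contra! h2
      exact h (Boundary.ext (funext h2))
    refine ⟨Nat.find h1, Boundary.pre_eq_of_letter_eq fun i hi => ?_, Nat.find_spec h1⟩
    exact not_not.1 (Nat.find_min h1 hi)
  -- the median is the end of the longest of the three common prefixes
  have hcase : ∀ {X Y Z : Boundary α} {i j k : ℕ}, X.pre i = Y.pre i → X.letter i ≠ Y.letter i →
      X.pre j = Z.pre j → X.letter j ≠ Z.letter j → Y.letter k ≠ Z.letter k →
      Y.pre k = Z.pre k → j ≤ i → k ≤ i →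
      ∃ g, dir g X ≠ dir g Y ∧ dir g X ≠ dir g Z ∧ dir g Y ≠ dir g Z := by
    intro X Y Z i j k hi hi' hj hj' hk' hk hji hki
    have hX := dir_mk_pre X i
    have hY := dir_mk_pre Y i
    rw [← hi] at hY
    refine ⟨mk (X.pre i), by rwa [hX, hY], ?_⟩
    rcases hji.lt_or_eq with hlt | rfl
    · have hZ := dir_mk_pre_of_lt hlt hj hj'
      obtain ⟨i, rfl⟩ : ∃ i', i = i' + 1 := ⟨i - 1, by omega⟩
      rw [hX, hY, hZ, Nat.add_sub_cancel]
      refine ⟨X.letter_succ_ne i, ?_⟩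
      rw [Boundary.letter_eq_of_pre_eq hi (Nat.lt_succ_self i)]
      exact Y.letter_succ_ne i
    · have hZ := dir_mk_pre Z j
      rw [← hj] at hZ
      rw [hX, hY, hZ]
      refine ⟨hj', ?_⟩
      rcases hki.lt_or_eq with hlt | rfl
      · exact absurd ((Boundary.letter_eq_of_pre_eq hi hlt).symm.trans
          (Boundary.letter_eq_of_pre_eq hj hlt)) hk'
      · exact hk'
  obtain ⟨i, hi, hi'⟩ := hsplit hXY
  obtain ⟨j, hj, hj'⟩ := hsplit hXZ
  obtain ⟨k, hk, hk'⟩ := hsplit hYZ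
  rcases (by omega : (j ≤ i ∧ k ≤ i) ∨ (i ≤ j ∧ k ≤ j) ∨ (i ≤ k ∧ j ≤ k)) with h | h | h
  · exact hcase hi hi' hj hj' hk' hk h.1 h.2
  · obtain ⟨g, h1, h2, h3⟩ := hcase hj hj' hi hi' hk'.symm hk.symm h.1 h.2
    exact ⟨g, h2, h1, h3.symm⟩
  · obtain ⟨g, h1, h2, h3⟩ := hcase hk hk' hi.symm hi'.symm hj'.symm hj.symm h.1 h.2
    exact ⟨g, h2.symm, h3.symm, h1⟩

end

section

/-! ### The cyclic order on the boundary of the free group of rank two -/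

/-- The rank of a letter in the cyclic order `a, b, a⁻¹, b⁻¹`, in which the fundamental group of
the once-punctured torus orders the edges at each vertex of its Cayley tree. -/
def letterRank (c : Fin 2 × Bool) : ℕ := c.1.val + if c.2 then 0 else 2

/-- The letters `c`, `d`, `e` are distinct and occur in this order on the circle
`a, b, a⁻¹, b⁻¹`. -/
def LetterCyc (c d e : Fin 2 × Bool) : Prop :=
  (letterRank c < letterRank d ∧ letterRank d < letterRank e) ∨
  (letterRank d < letterRank e ∧ letterRank e < letterRank c) ∨
  (letterRank e < letterRank c ∧ letterRank c < letterRank d)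

instance (c d e : Fin 2 × Bool) : Decidable (LetterCyc c d e) := by
  unfold LetterCyc; infer_instance

theorem LetterCyc.rotate {c d e : Fin 2 × Bool} (h : LetterCyc c d e) : LetterCyc d e c := by
  unfold LetterCyc at *; omega

theorem LetterCyc.asymm {c d e : Fin 2 × Bool} (h : LetterCyc c d e) : ¬ LetterCyc c e d := by
  unfold LetterCyc at *; omega

theorem LetterCyc.trans {c d e f : Fin 2 × Bool} (h : LetterCyc c d e) (h' : LetterCyc c e f) :
    LetterCyc c d f := by
  unfold LetterCyc at *; omega

theorem LetterCyc.ne {c d e : Fin 2 × Bool} (h : LetterCyc c d e) : c ≠ d ∧ c ≠ e ∧ d ≠ e := by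
  refine ⟨?_, ?_, ?_⟩ <;> rintro rfl <;> unfold LetterCyc at h <;> omega

theorem letterCyc_or {c d e : Fin 2 × Bool} (h1 : c ≠ d) (h2 : c ≠ e) (h3 : d ≠ e) :
    LetterCyc c d e ∨ LetterCyc c e d := by
  revert c d e; decide

/-- The cyclic order on the boundary of the free group of rank two: three points are compared by
the directions in which they leave some vertex. -/
def BoundaryCyc (X Y Z : Boundary (Fin 2)) : Prop :=
  ∃ g, LetterCyc (dir g X) (dir g Y) (dir g Z)

variable {X Y Z W : Boundary (Fin 2)}

theorem BoundaryCyc.rotate (h : BoundaryCyc X Y Z) : BoundaryCyc Y Z X :=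
  let ⟨g, hg⟩ := h; ⟨g, hg.rotate⟩

theorem BoundaryCyc.ne (h : BoundaryCyc X Y Z) : X ≠ Y ∧ X ≠ Z ∧ Y ≠ Z := by
  obtain ⟨g, hg⟩ := h
  refine ⟨?_, ?_, ?_⟩ <;> rintro rfl
  exacts [hg.ne.1 rfl, hg.ne.2.1 rfl, hg.ne.2.2 rfl]

theorem boundaryCyc_or (h1 : X ≠ Y) (h2 : X ≠ Z) (h3 : Y ≠ Z) :
    BoundaryCyc X Y Z ∨ BoundaryCyc X Z Y := by
  obtain ⟨g, h1, h2, h3⟩ := exists_dir_ne h1 h2 h3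
  exact (letterCyc_or h1 h2 h3).imp (fun h => ⟨g, h⟩) fun h => ⟨g, h⟩

theorem BoundaryCyc.asymm (h : BoundaryCyc X Y Z) : ¬ BoundaryCyc X Z Y := by
  rintro ⟨g', hg'⟩
  obtain ⟨g, hg⟩ := h
  by_cases hgg : g = g'
  · subst hgg
    exact hg.asymm hg'
  · -- the median is unique
    obtain ⟨c, d, hcd⟩ := exists_dir_eq_or hgg
    have := hg.ne
    have := hg'.ne
    grind

theorem BoundaryCyc.trans (h : BoundaryCyc X Y Z) (h' : BoundaryCyc X Z W) :
    BoundaryCyc X Y W := by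
  obtain ⟨g, hg⟩ := h
  obtain ⟨g', hg'⟩ := h'
  by_cases hgg : g = g'
  · subst hgg
    exact ⟨g, hg.trans hg'⟩
  · obtain ⟨c, d, hcd⟩ := exists_dir_eq_or hgg
    -- Either `W` can be replaced by `Z` in the view from `g`, or `Z` by `Y` in that from `g'`.
    by_cases hZ : dir g Z = c
    · refine ⟨g, ?_⟩
      have : dir g W = c := by
        have := hg.ne
        have := hg'.ne
        grind
      rwa [this, ← hZ]
    · refine ⟨g', ?_⟩
      have : dir g' Y = dir g' Z := by
        have := hg.ne
        have := hg'.ne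
        grind
      rwa [this]

/-- Points close to `X` do not lie on an arc from `Y` to `Z` that avoids `X`. -/
theorem eventually_not_boundaryCyc (h : BoundaryCyc X Y Z) :
    ∀ᶠ W in 𝓝 X, ¬ (BoundaryCyc X Y W ∧ BoundaryCyc X W Z) := by
  obtain ⟨g, hg⟩ := h
  filter_upwards [(isOpen_dir_eq g (dir g X)).mem_nhds rfl] with W hW ⟨h1, h2⟩
  have h3 : BoundaryCyc W Y Z := ⟨g, by rwa [show dir g W = dir g X from hW]⟩
  exact h3.asymm (h2.rotate.trans h1.rotate.rotate)

theorem boundaryCyc_translate_iff (g : FreeGroup (Fin 2)) :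
    BoundaryCyc (translate g X) (translate g Y) (translate g Z) ↔ BoundaryCyc X Y Z := by
  simp only [BoundaryCyc, dir_translate]
  refine ⟨fun ⟨h, hh⟩ => ⟨_, hh⟩, fun ⟨h, hh⟩ => ⟨g * h, by simpa using hh⟩⟩

/-! ### Automorphisms and the cyclic order -/

/-- The automorphism `φ` preserves the cyclic order on the boundary. -/
def PreservesCyc (φ : MulAut (FreeGroup (Fin 2))) : Prop :=
  ∀ X Y Z, BoundaryCyc X Y Z →
    BoundaryCyc (boundaryMap φ X) (boundaryMap φ Y) (boundaryMap φ Z)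

/-- The automorphism `φ` reverses the cyclic order on the boundary. -/
def ReversesCyc (φ : MulAut (FreeGroup (Fin 2))) : Prop :=
  ∀ X Y Z, BoundaryCyc X Y Z →
    BoundaryCyc (boundaryMap φ X) (boundaryMap φ Z) (boundaryMap φ Y)

variable {φ ψ : MulAut (FreeGroup (Fin 2))}

theorem ReversesCyc.mul (hφ : ReversesCyc φ) (hψ : ReversesCyc ψ) : PreservesCyc (φ * ψ) := by
  intro X Y Z h
  simpa only [boundaryMap_mul] using hφ _ _ _ (hψ X Y Z h)

theorem PreservesCyc.mul (hφ : PreservesCyc φ) (hψ : PreservesCyc ψ) :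
    PreservesCyc (φ * ψ) := by
  intro X Y Z h
  simpa only [boundaryMap_mul] using hφ _ _ _ (hψ X Y Z h)

theorem preservesCyc_or_reversesCyc_mul (hφ : PreservesCyc φ ∨ ReversesCyc φ)
    (hψ : PreservesCyc ψ ∨ ReversesCyc ψ) :
    PreservesCyc (φ * ψ) ∨ ReversesCyc (φ * ψ) := by
  rcases hφ with hφ | hφ <;> rcases hψ with hψ | hψ
  · exact .inl (hφ.mul hψ)
  · right
    intro X Y Z h
    simpa only [boundaryMap_mul] using hφ _ _ _ (hψ X Y Z h)
  · right
    intro X Y Z h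
    simpa only [boundaryMap_mul] using hφ _ _ _ (hψ X Y Z h)
  · exact .inl (hφ.mul hψ)

theorem preservesCyc_conj (g : FreeGroup (Fin 2)) : PreservesCyc (MulAut.conj g) :=
  fun _ _ _ h => (boundaryCyc_translate_iff g).2 h

/-- It suffices to test triples of points with distinct first letters. -/
theorem preservesCyc_of_letter
    (h : ∀ X Y Z : Boundary (Fin 2), LetterCyc (X.letter 0) (Y.letter 0) (Z.letter 0) →
      BoundaryCyc (boundaryMap φ X) (boundaryMap φ Y) (boundaryMap φ Z)) : PreservesCyc φ := by
  rintro X Y Z ⟨g, hg⟩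
  have h1 := h _ _ _ hg
  rwa [boundaryMap_translate, boundaryMap_translate, boundaryMap_translate,
    boundaryCyc_translate_iff] at h1

theorem reversesCyc_of_letter
    (h : ∀ X Y Z : Boundary (Fin 2), LetterCyc (X.letter 0) (Y.letter 0) (Z.letter 0) →
      BoundaryCyc (boundaryMap φ X) (boundaryMap φ Z) (boundaryMap φ Y)) : ReversesCyc φ := by
  rintro X Y Z ⟨g, hg⟩
  have h1 := h _ _ _ hg
  rwa [boundaryMap_translate, boundaryMap_translate, boundaryMap_translate,
    boundaryCyc_translate_iff] at h1

end

section

/-! ### Signed permutations and the transvection -/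

theorem head?_toWord_letter_mul {α : Type*} [DecidableEq α] {c : α × Bool} {g : FreeGroup α}
    (h : g.toWord.head? ≠ some (invLetter c)) : (mk [c] * g).toWord.head? = some c := by
  have h1 : IsReduced ([c] ++ g.toWord) := by
    refine isReduced_append .singleton isReduced_toWord fun d hd e he => ?_
    simp only [List.getLast?_singleton, Option.mem_def, Option.some.injEq] at hd he
    subst hd
    rintro rfl
    exact h he
  rw [← mk_toWord (x := g), mul_mk, toWord_mk, h1.reduce_eq]
  rfl

/-- The action on letters of the automorphism that permutes the two generators by `e` and inverts
the image of the generator `i` if `s i = false`. -/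
def signedLetter (e : Equiv.Perm (Fin 2)) (s : Fin 2 → Bool) (c : Fin 2 × Bool) : Fin 2 × Bool :=
  (e c.1, c.2 == s c.1)

/-- The endomorphism that sends the generator `i` to the generator `e i` or its inverse, according
to the sign `s i`. -/
def signedPermHom (e : Equiv.Perm (Fin 2)) (s : Fin 2 → Bool) :
    FreeGroup (Fin 2) →* FreeGroup (Fin 2) := lift fun i => mk [(e i, s i)]

theorem signedPermHom_mk (e : Equiv.Perm (Fin 2)) (s : Fin 2 → Bool) (w : List (Fin 2 × Bool)) :
    signedPermHom e s (mk w) = mk (w.map (signedLetter e s)) := by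
  induction w with
  | nil => simp [← one_eq_mk]
  | cons c w ih =>
    have h : ∀ v : List (Fin 2 × Bool), ∀ d, mk (d :: v) = mk [d] * mk v :=
      fun v d => by rw [mul_mk]; rfl
    rw [h, List.map_cons, h, _root_.map_mul, ih]
    obtain ⟨i, t⟩ := c
    cases t
    · simp [signedPermHom, signedLetter, inv_mk, invRev]
    · simp [signedPermHom, signedLetter]

/-- The automorphism that permutes the two generators by `e` and inverts
the image of the generator `i` if `s i = false`. -/
def signedPerm (e : Equiv.Perm (Fin 2)) (s : Fin 2 → Bool) : MulAut (FreeGroup (Fin 2)) :=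
  MonoidHom.toMulEquiv (signedPermHom e s) (signedPermHom e.symm fun i => s (e.symm i))
    (by
      ext i
      rw [MonoidHom.comp_apply, MonoidHom.id_apply, of]
      simp [signedPermHom_mk, signedLetter])
    (by
      ext i
      rw [MonoidHom.comp_apply, MonoidHom.id_apply, of]
      simp [signedPermHom_mk, signedLetter])

theorem signedPerm_mk (e : Equiv.Perm (Fin 2)) (s : Fin 2 → Bool) (w : List (Fin 2 × Bool)) :
    signedPerm e s (mk w) = mk (w.map (signedLetter e s)) := signedPermHom_mk e s w

theorem signedLetter_invLetter (e : Equiv.Perm (Fin 2)) (s : Fin 2 → Bool) (c : Fin 2 × Bool) :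
    signedLetter e s (invLetter c) = invLetter (signedLetter e s c) := by
  obtain ⟨i, t⟩ := c
  cases t <;> cases h : s i <;> simp [signedLetter, invLetter, h]

theorem signedLetter_injective (e : Equiv.Perm (Fin 2)) (s : Fin 2 → Bool) :
    Function.Injective (signedLetter e s) := by
  rintro ⟨i, t⟩ ⟨j, u⟩ h
  simp only [signedLetter, Prod.mk.injEq, EmbeddingLike.apply_eq_iff_eq] at h
  obtain ⟨rfl, h⟩ := h
  revert h
  cases t <;> cases u <;> cases s i <;> simp

theorem boundaryMap_signedPerm_letter_zero (e : Equiv.Perm (Fin 2)) (s : Fin 2 → Bool)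
    (X : Boundary (Fin 2)) :
    (boundaryMap (signedPerm e s) X).letter 0 = signedLetter e s (X.letter 0) := by
  obtain ⟨n, hn, hn0⟩ := ((boundaryMap_spec (signedPerm e s) X).eventually_head?.and
    (eventually_ge_atTop 1)).exists
  have h1 : IsReduced ((X.pre n).map (signedLetter e s)) := by
    have h2 := X.pre_isReduced n
    unfold IsReduced at *
    rw [List.isChain_map]
    refine h2.imp fun c d hcd => ?_
    rw [← ne_invLetter_iff] at *
    rw [← signedLetter_invLetter]
    exact fun h => hcd (signedLetter_injective e s h)
  rw [signedPerm_mk, toWord_mk, h1.reduce_eq, List.head?_map, List.head?_eq_getElem?,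
    X.pre_getElem? (by omega)] at hn
  exact (Option.some.inj hn).symm

theorem preservesCyc_or_reversesCyc_signedPerm (e : Equiv.Perm (Fin 2)) (s : Fin 2 → Bool) :
    PreservesCyc (signedPerm e s) ∨ ReversesCyc (signedPerm e s) := by
  have key : (∀ c d f, LetterCyc c d f → LetterCyc (signedLetter e s c) (signedLetter e s d)
      (signedLetter e s f)) ∨ (∀ c d f, LetterCyc c d f → LetterCyc (signedLetter e s c)
      (signedLetter e s f) (signedLetter e s d)) := by
    revert e s; decide
  refine key.imp (fun h => preservesCyc_of_letter fun X Y Z hc => ⟨1, ?_⟩)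
    fun h => reversesCyc_of_letter fun X Y Z hc => ⟨1, ?_⟩
  all_goals
    simp only [dir_one, boundaryMap_signedPerm_letter_zero]
    exact h _ _ _ hc

/-- The transvection `a ↦ a b`, `b ↦ b`. -/
def transvection : MulAut (FreeGroup (Fin 2)) :=
  MonoidHom.toMulEquiv (lift ![of 0 * of 1, of 1]) (lift ![of 0 * (of 1)⁻¹, of 1])
    (by ext i; fin_cases i <;> simp) (by ext i; fin_cases i <;> simp)

@[simp] theorem transvection_of_zero : transvection (of 0) = of 0 * of 1 := by
  simp [transvection]

@[simp] theorem transvection_of_one : transvection (of 1) = of 1 := by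
  simp [transvection]

/-- The first letters of the images under the transvection, seen from `1` and from `b⁻¹`. -/
theorem head?_transvection {w : List (Fin 2 × Bool)} (hw : IsReduced w) :
    let t := transvection (mk w)
    let F := t.toWord.head?
    let G := (of 1 * t).toWord.head?
    (w.head? = none → F = none ∧ G = some (1, true)) ∧
    (w.head? = some (0, true) → F = some (0, true) ∧ G = some (1, true)) ∧
    (w.head? = some (1, true) → (F = some (1, true) ∨ F = some (0, false)) ∧
      G = some (1, true)) ∧
    (w.head? = some (0, false) → F = some (1, false) ∧ G = some (0, false)) ∧
    (w.head? = some (1, false) → F = some (1, false) ∧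
      (G = some (1, false) ∨ G = some (0, true) ∨ G = none)) := by
  induction w with
  | nil => simp [← one_eq_mk]
  | cons c w ih =>
    have hc : mk (c :: w) = mk [c] * mk w := by rw [mul_mk]; rfl
    have h1 : w.head? ≠ some (invLetter c) := by
      cases w with
      | nil => simp
      | cons d w =>
        have := (isReduced_cons_cons.1 hw).1
        rw [← ne_invLetter_iff] at this
        simpa using this
    have ih := ih (hw.infix ⟨[c], [], by simp⟩)
    have hof : ∀ i : Fin 2, (of i : FreeGroup (Fin 2)) = mk [(i, true)] := fun i => rfl
    have hof' : ∀ i : Fin 2, (mk [(i, false)] : FreeGroup (Fin 2)) = (of i)⁻¹ := fun i => rfl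
    have hall : ∀ o : Option (Fin 2 × Bool), o = none ∨ o = some (0, true) ∨
        o = some (1, true) ∨ o = some (0, false) ∨ o = some (1, false) := by decide
    have hcases : c = (0, true) ∨ c = (1, true) ∨ c = (0, false) ∨ c = (1, false) := by
      clear hc h1 hw; revert c; decide
    generalize ht : transvection (mk w) = t at ih
    rw [hc, _root_.map_mul, ht]
    have h2 := hall w.head?
    rcases hcases with rfl | rfl | rfl | rfl <;> simp only [invLetter] at h1
    · have e0 : (of 1 * t).toWord.head? ≠ some (0, false) := by grind
      have e1 : (of 0 * (of 1 * t)).toWord.head? = some (0, true) := head?_toWord_letter_mul e0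
      have e2 : (of 1 * (of 0 * (of 1 * t))).toWord.head? = some (1, true) :=
        head?_toWord_letter_mul (by rw [e1]; decide)
      rw [← hof 0, transvection_of_zero, mul_assoc]
      simp [e1, e2]
    · have e0 : (of 1 * t).toWord.head? = some (1, true) ∨
          (of 1 * t).toWord.head? = some (0, false) := by grind
      have e1 : (of 1 * (of 1 * t)).toWord.head? = some (1, true) :=
        head?_toWord_letter_mul (by rcases e0 with e0 | e0 <;> rw [e0] <;> decide)
      rw [← hof 1, transvection_of_one]
      simp [e0, e1]
    · have e0 : t.toWord.head? ≠ some (0, true) := by grind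
      have e1 : ((of 0)⁻¹ * t).toWord.head? = some (0, false) :=
        head?_toWord_letter_mul (c := (0, false)) e0
      have e2 : ((of 1)⁻¹ * ((of 0)⁻¹ * t)).toWord.head? = some (1, false) :=
        head?_toWord_letter_mul (c := (1, false)) (by rw [e1]; decide)
      rw [hof' 0, _root_.map_inv, transvection_of_zero, mul_inv_rev, mul_assoc]
      simp [e1, e2]
    · have e0 : t.toWord.head? ≠ some (1, true) := by grind
      have e1 : ((of 1)⁻¹ * t).toWord.head? = some (1, false) :=
        head?_toWord_letter_mul (c := (1, false)) e0
      have e2 : t.toWord.head? = some (1, false) ∨ t.toWord.head? = some (0, true) ∨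
        t.toWord.head? = none := by grind
      rw [hof' 1, _root_.map_inv, transvection_of_one]
      simpa [e1] using e2

/-- The possible directions of the image of `X` under the transvection at the vertices `1` and
`b⁻¹`, given the first letter of `X`. -/
def transvectionDirs (c : Fin 2 × Bool) : List ((Fin 2 × Bool) × (Fin 2 × Bool)) :=
  if c = (0, true) then [((0, true), (1, true))]
  else if c = (1, true) then [((1, true), (1, true)), ((0, false), (1, true))]
  else if c = (0, false) then [((1, false), (0, false))]
  else [((1, false), (1, false)), ((1, false), (0, true))]

theorem dir_transvection (X : Boundary (Fin 2)) :
    (dir 1 (boundaryMap transvection X), dir (of 1)⁻¹ (boundaryMap transvection X)) ∈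
      transvectionDirs (X.letter 0) := by
  have h1 := boundaryMap_spec transvection X
  obtain ⟨n, ⟨hn1, hn2⟩, hn⟩ := ((h1.eventually_head?.and
    (h1.translate (of 1)).eventually_head?).and (eventually_ge_atTop 1)).exists
  have h2 := head?_transvection (X.pre_isReduced n)
  have h3 : (X.pre n).head? = some (X.letter 0) := by
    rw [List.head?_eq_getElem?, X.pre_getElem? (by omega)]
  simp only [hn1, hn2, h3, ← dir_one (boundaryMap transvection X), Option.some.injEq,
    reduceCtorEq, or_false] at h2
  have h4 : dir (of 1)⁻¹ (boundaryMap transvection X) =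
    (translate (of 1) (boundaryMap transvection X)).letter 0 := by simp [dir]
  rw [← h4] at h2
  have hcases : ∀ c : Fin 2 × Bool,
      c = (0, true) ∨ c = (1, true) ∨ c = (0, false) ∨ c = (1, false) := by decide
  rcases hcases (X.letter 0) with h | h | h | h <;>
    simp only [h, transvectionDirs] at h2 ⊢ <;> simpa [and_or_left, or_and_right] using h2

set_option synthInstance.maxHeartbeats 200000 in
set_option synthInstance.maxSize 1000 in
theorem preservesCyc_transvection : PreservesCyc transvection := by
  refine preservesCyc_of_letter fun X Y Z h => ?_
  have key : ∀ x y z, LetterCyc x y z → ∀ p ∈ transvectionDirs x, ∀ q ∈ transvectionDirs y,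
      ∀ r ∈ transvectionDirs z, LetterCyc p.1 q.1 r.1 ∨ LetterCyc p.2 q.2 r.2 := by decide
  exact (key _ _ _ h _ (dir_transvection X) _ (dir_transvection Y) _ (dir_transvection Z)).elim
    (fun h => ⟨_, h⟩) fun h => ⟨_, h⟩

end

section

theorem PreservesCyc.inv {φ : MulAut (FreeGroup (Fin 2))} (h : PreservesCyc φ) :
    PreservesCyc φ⁻¹ := by
  have hinv : ∀ X, boundaryMap φ (boundaryMap φ⁻¹ X) = X := boundaryMap_apply_symm φ
  intro X Y Z hc
  have hinj := boundaryMap_injective φ⁻¹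
  have hne := hc.ne
  refine (boundaryCyc_or (hinj.ne hne.1) (hinj.ne hne.2.1) (hinj.ne hne.2.2)).resolve_right
    fun h1 => ?_
  have h2 := h _ _ _ h1
  rw [hinv, hinv, hinv] at h2
  exact hc.asymm h2

theorem ReversesCyc.inv {φ : MulAut (FreeGroup (Fin 2))} (h : ReversesCyc φ) :
    ReversesCyc φ⁻¹ := by
  have hinv : ∀ X, boundaryMap φ (boundaryMap φ⁻¹ X) = X := boundaryMap_apply_symm φ
  intro X Y Z hc
  have hinj := boundaryMap_injective φ⁻¹
  have hne := hc.ne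
  refine (boundaryCyc_or (hinj.ne hne.1) (hinj.ne hne.2.1) (hinj.ne hne.2.2)).resolve_left
    fun h1 => ?_
  have h2 := h _ _ _ h1
  rw [hinv, hinv, hinv] at h2
  exact hc.asymm h2

theorem preservesCyc_or_reversesCyc_inv {φ : MulAut (FreeGroup (Fin 2))}
    (h : PreservesCyc φ ∨ ReversesCyc φ) : PreservesCyc φ⁻¹ ∨ ReversesCyc φ⁻¹ :=
  h.imp PreservesCyc.inv ReversesCyc.inv

/-! ### Nielsen reduction in rank two -/

theorem mk_drop_toWord {α : Type*} [DecidableEq α] (g : FreeGroup α) (h : ℕ) :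
    mk (g.toWord.drop (g.norm - h)) = (mk (g⁻¹.toWord.take h))⁻¹ := by
  rw [toWord_inv, inv_mk]
  unfold invRev
  rw [List.take_reverse, List.map_reverse, List.reverse_reverse, List.length_map,
    ← List.map_drop, List.map_map]
  simp [norm, Function.comp_def]

/-- Conjugation shortens a pair `(u, v)` for which `u v u` cancels the whole of `v`, one half on
either side. -/
theorem exists_conj_norm_lt {α : Type*} [DecidableEq α] {u v : FreeGroup α} (hv : v ≠ 1)
    (h1 : 2 * gromovProduct u⁻¹ v = v.norm) (h2 : 2 * gromovProduct v⁻¹ u = v.norm)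
    (h3 : v.norm ≤ u.norm) :
    ∃ q, (q⁻¹ * (u * v) * q).norm + (q⁻¹ * v * q).norm < u.norm + v.norm := by
  set h := gromovProduct u⁻¹ v with hh
  have h0 : 0 < h := by
    have : v.norm ≠ 0 := by simpa using hv
    omega
  have e1 := (le_gromovProduct_iff.1 (hh.le)).2.2
  have e2 := (le_gromovProduct_iff.1 (show h ≤ gromovProduct v⁻¹ u by omega)).2.2
  set p := v.toWord.take h with hp
  set q := u.toWord.take h with hq
  have hv2 : v = mk p * (mk q)⁻¹ := by
    have := mk_drop_toWord v h
    rw [e2, show v.norm - h = h by omega] at this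
    rw [← this, mul_mk, hp, List.take_append_drop, mk_toWord]
  set m := (u.toWord.drop h).take (u.norm - 2 * h) with hm
  have hu2 : u = mk q * mk m * (mk p)⁻¹ := by
    have := mk_drop_toWord u h
    rw [e1] at this
    rw [← this, mul_mk, mul_mk, List.append_assoc,
      show u.norm - h = h + (u.norm - 2 * h) by omega, ← List.drop_drop, hm,
      List.take_append_drop, hq, List.take_append_drop, mk_toWord]
  refine ⟨mk q, ?_⟩
  have f1 : (mk q)⁻¹ * (u * v) * mk q = mk m := by
    rw [hu2, hv2]; group
  have f2 : (mk q)⁻¹ * v * mk q = (mk q)⁻¹ * mk p := by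
    rw [hv2]; group
  have f3 : (mk m).norm ≤ u.norm - 2 * h := norm_mk_le.trans (by simp [hm])
  have f4 : ((mk q)⁻¹ * mk p).norm ≤ h + h := by
    refine (norm_mul_le _ _).trans (add_le_add ?_ ?_)
    · rw [norm_inv_eq]; exact norm_mk_le.trans (by simp [hq])
    · exact norm_mk_le.trans (by simp [hp])
  rw [f1, f2]
  omega

/-- No transvection followed by a conjugation shortens the basis given by `φ`. -/
def IsNielsenMinimal (φ : MulAut (FreeGroup (Fin 2))) : Prop :=
  ∀ x y : Fin 2 × Bool, x.1 ≠ y.1 → ∀ g : FreeGroup (Fin 2),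
    (φ (mk [x])).norm + (φ (mk [y])).norm ≤
      (g⁻¹ * (φ (mk [x]) * φ (mk [y])) * g).norm + (g⁻¹ * φ (mk [y]) * g).norm

theorem map_mk_invLetter (φ : MulAut (FreeGroup (Fin 2))) (c : Fin 2 × Bool) :
    φ (mk [invLetter c]) = (φ (mk [c]))⁻¹ := by
  rw [mk_invLetter, _root_.map_inv]

theorem map_mk_letter_ne_one (φ : MulAut (FreeGroup (Fin 2))) (c : Fin 2 × Bool) :
    φ (mk [c]) ≠ 1 := by
  intro h
  have h1 : mk [c] = 1 := φ.injective (h.trans (_root_.map_one φ).symm)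
  have h2 := congrArg toWord h1
  simp at h2

variable {φ : MulAut (FreeGroup (Fin 2))}

theorem IsNielsenMinimal.two_mul_gromovProduct_le (h : IsNielsenMinimal φ) {x y : Fin 2 × Bool}
    (hxy : x.1 ≠ y.1) :
    2 * gromovProduct (φ (mk [x]))⁻¹ (φ (mk [y])) ≤ (φ (mk [x])).norm ∧
    2 * gromovProduct (φ (mk [x]))⁻¹ (φ (mk [y])) ≤ (φ (mk [y])).norm := by
  have key : ∀ {x y : Fin 2 × Bool}, x.1 ≠ y.1 →
      2 * gromovProduct (φ (mk [x]))⁻¹ (φ (mk [y])) ≤ (φ (mk [y])).norm := by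
    intro x y hxy
    have h1 := h x y hxy 1
    have h2 := norm_mul_add (φ (mk [x])) (φ (mk [y]))
    simp only [inv_one, one_mul, mul_one] at h1
    omega
  refine ⟨?_, key hxy⟩
  have h1 := key (x := invLetter y) (y := invLetter x) hxy.symm
  rwa [map_mk_invLetter, map_mk_invLetter, inv_inv, gromovProduct_comm, norm_inv_eq] at h1

/-- In a product of images of letters under a Nielsen minimal automorphism, no factor is cancelled
entirely by its neighbours. -/
theorem IsNielsenMinimal.gromovProduct_add_lt (h : IsNielsenMinimal φ) {x y z : Fin 2 × Bool}
    (hxy : y ≠ invLetter x) (hyz : z ≠ invLetter y) :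
    gromovProduct (φ (mk [x]))⁻¹ (φ (mk [y])) + gromovProduct (φ (mk [y]))⁻¹ (φ (mk [z])) <
      (φ (mk [y])).norm := by
  have heq : ∀ {x y : Fin 2 × Bool}, y ≠ invLetter x → x.1 = y.1 → x = y := by
    intro x y h1 h2
    exact Prod.ext h2 (ne_invLetter_iff.1 h1 h2)
  have hlt := two_mul_gromovProduct_inv_lt (map_mk_letter_ne_one φ y)
  by_cases h1 : x.1 = y.1
  · obtain rfl := heq hxy h1
    by_cases h2 : x.1 = z.1
    · obtain rfl := heq hyz h2
      omega
    · have := (h.two_mul_gromovProduct_le h2).1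
      omega
  · have hx := (h.two_mul_gromovProduct_le h1)
    by_cases h2 : y.1 = z.1
    · obtain rfl := heq hyz h2
      omega
    · have hz := (h.two_mul_gromovProduct_le h2)
      by_contra hge
      by_cases hzx : z = invLetter x
      · subst hzx
        rw [map_mk_invLetter] at hge hz
        have h3 := min_gromovProduct_le (φ (mk [y]))⁻¹ (φ (mk [x]))⁻¹ (φ (mk [y]))
        omega
      · have h3 : x.1 = z.1 := by
          revert h1 h2; generalize x.1 = i; generalize y.1 = j; generalize z.1 = k
          revert i j k; decide
        obtain rfl := heq hzx h3
        obtain ⟨q, hq⟩ := exists_conj_norm_lt (map_mk_letter_ne_one φ y)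
          (u := φ (mk [x])) (by omega) (by omega) (by omega)
        exact absurd (h x y h1 q) (by omega)

/-- The length of the image of a reduced word under a Nielsen minimal automorphism: the letters
next to each other cancel as they do in pairs, and something remains of every factor. -/
theorem IsNielsenMinimal.norm_map_mk (h : IsNielsenMinimal φ) (w : List (Fin 2 × Bool))
    {x y : Fin 2 × Bool} (hw : IsReduced (x :: y :: w)) :
    (φ (mk (x :: y :: w))).norm + 2 * gromovProduct (φ (mk [x]))⁻¹ (φ (mk [y])) =
      (φ (mk (y :: w))).norm + (φ (mk [x])).norm ∧
    w.length + 1 + (φ (mk [x])).norm ≤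
      (φ (mk (x :: y :: w))).norm + gromovProduct (φ (mk [x]))⁻¹ (φ (mk [y])) := by
  have hcons : ∀ (c : Fin 2 × Bool) v, φ (mk (c :: v)) = φ (mk [c]) * φ (mk v) := by
    intro c v
    rw [← _root_.map_mul, mul_mk]; rfl
  induction w generalizing x y with
  | nil =>
    have hxy := ne_invLetter_iff.2 (isReduced_cons_cons.1 hw).1
    have hyy : y ≠ invLetter y := by simp [invLetter, Prod.ext_iff]
    have h1 := h.gromovProduct_add_lt hxy hyy
    have h2 := norm_mul_add (φ (mk [x])) (φ (mk [y]))
    rw [hcons x [y]]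
    simp only [List.length_nil]
    omega
  | cons z w ih =>
    have hxy := ne_invLetter_iff.2 (isReduced_cons_cons.1 hw).1
    have hw' := (isReduced_cons_cons.1 hw).2
    have hyz := ne_invLetter_iff.2 (isReduced_cons_cons.1 hw').1
    have h1 := h.gromovProduct_add_lt hxy hyz
    obtain ⟨h2, h3⟩ := ih hw'
    -- the first letters of `φ (y z w)` are those of `φ y`, as far as `φ x` can cancel them
    have h4 := norm_inv_mul_add (φ (mk [y])) (φ (mk (y :: z :: w)))
    rw [hcons y (z :: w), inv_mul_cancel_left, ← hcons y (z :: w)] at h4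
    have h5 := gromovProduct_eq_of_lt (g := φ (mk (y :: z :: w))) (h := φ (mk [y]))
      (k := (φ (mk [x]))⁻¹)
    rw [gromovProduct_comm _ (φ (mk [y])), gromovProduct_comm _ (φ (mk [x]))⁻¹,
      gromovProduct_comm _ (φ (mk [x]))⁻¹] at h5
    have h6 := h5 (by omega)
    have h7 := norm_mul_add (φ (mk [x])) (φ (mk (y :: z :: w)))
    rw [← hcons] at h7
    simp only [List.length_cons]
    omega

theorem IsNielsenMinimal.norm_le (h : IsNielsenMinimal φ) (g : FreeGroup (Fin 2)) :
    g.norm ≤ (φ g).norm := by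
  obtain ⟨w, hw, rfl⟩ : ∃ w, IsReduced w ∧ g = mk w := ⟨_, isReduced_toWord, mk_toWord.symm⟩
  rw [hw.norm_mk]
  match w, hw with
  | [], _ => simp
  | [x], _ =>
    have : (φ (mk [x])).norm ≠ 0 := by simpa using map_mk_letter_ne_one φ x
    simp only [List.length_singleton]
    omega
  | x :: y :: w, hw =>
    have h1 := (h.norm_map_mk w hw).2
    have hxy := ne_invLetter_iff.2 (isReduced_cons_cons.1 hw).1
    have hxx : x ≠ invLetter x := by simp [invLetter, Prod.ext_iff]
    have h2 := h.gromovProduct_add_lt (x := x) hxx hxy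
    simp only [List.length_cons]
    omega

/-- Two letters on different generators form a basis. -/
theorem exists_signedPerm {x y : Fin 2 × Bool} (hxy : x.1 ≠ y.1) :
    ∃ e s, signedPerm e s (of 0) = mk [x] ∧ signedPerm e s (of 1) = mk [y] := by
  refine ⟨Equiv.swap 0 x.1, ![x.2, y.2], ?_, ?_⟩
  · rw [of, signedPerm_mk]
    simp [signedLetter]
  · have : Equiv.swap 0 x.1 1 = y.1 := by
      revert hxy; generalize x.1 = i; generalize y.1 = j; revert i j; decide
    rw [of, signedPerm_mk]
    simp [signedLetter, this]

theorem mulAut_ext {φ ψ : MulAut (FreeGroup (Fin 2))} (h0 : φ (of 0) = ψ (of 0))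
    (h1 : φ (of 1) = ψ (of 1)) : φ = ψ := by
  have : φ.toMonoidHom = ψ.toMonoidHom := by
    ext i
    fin_cases i
    · exact h0
    · exact h1
  ext g
  exact DFunLike.congr_fun this g

theorem IsNielsenMinimal.exists_inv_eq_signedPerm (h : IsNielsenMinimal φ) :
    ∃ e s, φ⁻¹ = signedPerm e s := by
  have hc : ∀ i : Fin 2, ∃ c, φ⁻¹ (of i) = mk [c] := by
    intro i
    have h1 := h.norm_le (φ⁻¹ (of i))
    rw [MulAut.apply_inv_self, norm_of] at h1
    have h2 : (φ⁻¹ (of i)).norm ≠ 0 := by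
      rw [Ne, norm_eq_zero]
      exact map_mk_letter_ne_one φ⁻¹ (i, true)
    obtain ⟨c, hc⟩ := List.length_eq_one_iff.1 (show (φ⁻¹ (of i)).toWord.length = 1 by
      unfold norm at *; omega)
    exact ⟨c, by rw [← hc, mk_toWord]⟩
  obtain ⟨x, hx⟩ := hc 0
  obtain ⟨y, hy⟩ := hc 1
  have hxy : x.1 ≠ y.1 := by
    intro h1
    by_cases h2 : y = invLetter x
    · rw [h2, mk_invLetter, ← hx, ← _root_.map_inv] at hy
      have h3 := congrArg toWord (φ⁻¹.injective hy)
      simp [toWord_inv, invRev] at h3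
    · have h3 : x = y := Prod.ext h1 (ne_invLetter_iff.1 h2 h1)
      rw [← h3, ← hx] at hy
      exact absurd (of_injective (φ⁻¹.injective hy)) (by decide)
  obtain ⟨e, s, h0, h1⟩ := exists_signedPerm hxy
  exact ⟨e, s, mulAut_ext (hx.trans h0.symm) (hy.trans h1.symm)⟩

/-- Every automorphism of the free group of rank two preserves or reverses the cyclic order on the
boundary: this holds for signed permutations, transvections and conjugations, and Nielsen reduction
writes every automorphism as a product of these. -/
theorem preservesCyc_or_reversesCyc (φ : MulAut (FreeGroup (Fin 2))) :
    PreservesCyc φ ∨ ReversesCyc φ := by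
  induction hn : (φ (of 0)).norm + (φ (of 1)).norm using Nat.strong_induction_on
    generalizing φ with
  | _ n ih =>
    by_cases hmin : IsNielsenMinimal φ
    · obtain ⟨e, s, hes⟩ := hmin.exists_inv_eq_signedPerm
      have := preservesCyc_or_reversesCyc_inv (preservesCyc_or_reversesCyc_signedPerm e s)
      rwa [← hes, inv_inv] at this
    · simp only [IsNielsenMinimal, not_forall, not_le] at hmin
      obtain ⟨x, y, hxy, g, hlt⟩ := hmin
      obtain ⟨e, s, h0, h1⟩ := exists_signedPerm hxy
      have hsum : (φ (mk [x])).norm + (φ (mk [y])).norm = n := by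
        have hN : ∀ c : Fin 2 × Bool, (φ (mk [c])).norm = (φ (of c.1)).norm := by
          rintro ⟨i, t⟩
          cases t
          · have := map_mk_invLetter φ (i, true)
            simp only [invLetter, Bool.not_true] at this
            rw [this, norm_inv_eq]; rfl
          · rfl
        rw [hN, hN, ← hn]
        revert hxy
        generalize x.1 = i; generalize y.1 = j
        intro hij
        fin_cases i <;> fin_cases j <;> simp at hij ⊢
        exact add_comm _ _
      set τ := signedPerm e s * transvection with hτ
      have hφ : φ (mk [x, y]) = φ (mk [x]) * φ (mk [y]) := by
        rw [← _root_.map_mul, mul_mk]; rfl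
      have hP := ih _ (hsum ▸ hlt) (MulAut.conj g⁻¹ * φ * τ) (by
        simp [hτ, h0, h1, hφ])
      have hτP := preservesCyc_or_reversesCyc_inv (preservesCyc_or_reversesCyc_mul
        (preservesCyc_or_reversesCyc_signedPerm e s) (.inl preservesCyc_transvection))
      have := preservesCyc_or_reversesCyc_mul
        (preservesCyc_or_reversesCyc_mul (.inl (preservesCyc_conj g)) hP) hτP
      rw [← hτ] at this
      convert this using 2 <;> rw [_root_.map_inv] <;> group

end

section

/-! ### Bounded cancellation -/

variable {α : Type*} [DecidableEq α]

/-- A path with jumps of length at most `C` that enters the branch of the tree behind the vertex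
`q.toWord.take m` passes at bounded distance from that vertex. -/
theorem exists_norm_le_of_path {z : ℕ → FreeGroup α} {C : ℕ}
    (hz : ∀ i, ((z i)⁻¹ * z (i + 1)).norm ≤ C) {q : List (α × Bool)} {m s t : ℕ} (hst : s ≤ t)
    (hs : (z s).toWord.take m ≠ q.take m ∨ (z s).norm ≤ m + C)
    (ht : (z t).toWord.take m = q.take m) :
    ∃ i, s ≤ i ∧ i ≤ t ∧ (z i).toWord.take m = q.take m ∧ (z i).norm ≤ m + C := by
  by_cases hsm : (z s).toWord.take m = q.take m
  · exact ⟨s, le_rfl, hst, hsm, hs.resolve_left (not_not.2 hsm)⟩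
  induction t, hst using Nat.le_induction with
  | base => exact absurd ht hsm
  | succ t hst ih =>
    by_cases htm : (z t).toWord.take m = q.take m
    · obtain ⟨i, h1, h2, h3⟩ := ih htm
      exact ⟨i, h1, h2.trans (Nat.le_succ t), h3⟩
    · refine ⟨t + 1, by omega, le_rfl, ht, ?_⟩
      by_contra! hlt
      refine htm ?_
      have h1 := take_toWord_mul (z (t + 1)) ((z (t + 1))⁻¹ * z t).toWord (m := m) (by
        have h2 := hz t
        rw [← norm_inv_eq, mul_inv_rev, inv_inv] at h2
        unfold norm at *
        omega)
      rw [mk_toWord, mul_inv_cancel_left] at h1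
      rw [h1, ht]

variable [Finite α]

/-- Bounded cancellation: if no cancellation occurs between the words `u` and `w`, then only a
bounded part of `φ u` is cancelled in the product `φ u * φ w`. -/
theorem exists_bounded_cancellation (φ : FreeGroup α ≃* FreeGroup α) :
    ∃ B, ∀ u w : List (α × Bool), IsReduced (u ++ w) →
      (φ (mk u)).norm ≤ gromovProduct (φ (mk u)) (φ (mk (u ++ w))) + B := by
  obtain ⟨C, hC⟩ := exists_norm_map_le φ.toMonoidHom
  obtain ⟨D, hD⟩ := exists_norm_map_le φ.symm.toMonoidHom
  replace hC : ∀ g, (φ g).norm ≤ C * g.norm := hC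
  replace hD : ∀ g, (φ.symm g).norm ≤ D * g.norm := hD
  refine ⟨C + C * (D * (2 * C + 1)), fun u w hW => ?_⟩
  set W := u ++ w with hWdef
  set z : ℕ → FreeGroup α := fun i => φ (mk (W.take i)) with hzdef
  have hdiff : ∀ {i j}, i ≤ j → (z i)⁻¹ * z j = φ (mk ((W.take j).drop i)) := by
    intro i j hij
    rw [hzdef, ← _root_.map_inv, ← _root_.map_mul, inv_mul_eq_iff_eq_mul.2]
    rw [mul_mk]
    congr 1
    conv_lhs => rw [← List.take_append_drop i (W.take j)]
    rw [List.take_take, min_eq_left hij]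
  have hlip : ∀ {i j}, i ≤ j → ((z i)⁻¹ * z j).norm ≤ C * (j - i) := by
    intro i j hij
    rw [hdiff hij]
    refine (hC _).trans (Nat.mul_le_mul_left C (norm_mk_le.trans ?_))
    simp only [List.length_drop, List.length_take]
    omega
  have hstep : ∀ i, ((z i)⁻¹ * z (i + 1)).norm ≤ C := fun i => by
    simpa using hlip (Nat.le_succ i)
  have hu : φ (mk u) = z u.length := by simp [hzdef, hWdef]
  have hWz : φ (mk W) = z W.length := by simp [hzdef]
  have hlen : u.length ≤ W.length := by simp [hWdef]
  rw [hu, hWz]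
  set p := z u.length with hp
  set q := z W.length with hq
  set m := gromovProduct p q with hm
  obtain ⟨hmp, hmq, hpq⟩ := le_gromovProduct_iff.1 hm.le
  -- The path passes near the end of the common prefix of `p` and `q` both before and after `p`.
  obtain ⟨i, -, hi, hi1, hi2⟩ := exists_norm_le_of_path hstep (q := p.toWord) (m := m)
    (Nat.zero_le u.length) (by right; simp [hzdef, ← one_eq_mk]) rfl
  obtain ⟨j, hj, hjW, hj1, hj2⟩ := exists_norm_le_of_path hstep (q := q.toWord) (m := m + 1)
    hlen (by
      by_cases hpm : p.norm ≤ m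
      · right
        change p.norm ≤ m + 1 + C
        omega
      · left
        intro (h : p.toWord.take (m + 1) = q.toWord.take (m + 1))
        have h1 := congrArg List.length h
        rw [List.length_take, List.length_take] at h1
        have h2 : m + 1 ≤ gromovProduct p q := by
          refine le_gromovProduct_iff.2 ⟨by omega, ?_, h⟩
          unfold norm at *
          omega
        omega) rfl
  have hj3 : (z j).toWord.take m = q.toWord.take m := by
    have := congrArg (List.take m) hj1
    simpa [List.take_take] using this
  have hlen' : ∀ {g h : FreeGroup α}, g.toWord.take m = h.toWord.take m → m ≤ h.norm →
      m ≤ g.norm := by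
    intro g h h1 h2
    have h3 := congrArg List.length h1
    rw [List.length_take, List.length_take] at h3
    unfold norm at *
    omega
  have hgp : m ≤ gromovProduct (z i) (z j) := le_gromovProduct_iff.2
    ⟨hlen' hi1 hmp, hlen' hj3 hmq, hi1.trans (hpq.trans hj3.symm)⟩
  have hdist := norm_inv_mul_add (z i) (z j)
  have hij : i ≤ j := hi.trans hj
  -- Hence the two passages are close in time, and `p` lies in between.
  have hji : j - i ≤ D * (2 * C + 1) := by
    have h1 := hD ((z i)⁻¹ * z j)
    rw [hdiff hij, φ.symm_apply_apply, IsReduced.norm_mk, ← hdiff hij] at h1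
    · simp only [List.length_drop, List.length_take] at h1
      have h2 : D * ((z i)⁻¹ * z j).norm ≤ D * (2 * C + 1) := Nat.mul_le_mul_left D (by omega)
      omega
    · exact hW.infix ((List.drop_suffix _ _).isInfix.trans (List.take_prefix _ _).isInfix)
  have h1 := hlip hi
  have h2 : C * (u.length - i) ≤ C * (D * (2 * C + 1)) := Nat.mul_le_mul_left C (by omega)
  have h3 : p.norm ≤ (z i).norm + ((z i)⁻¹ * p).norm := by
    simpa using norm_mul_le (z i) ((z i)⁻¹ * p)
  rw [← hp] at h1
  omega

/-- The image of a boundary point `X` agrees with the images of the prefixes of `X`, up to a suffix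
of bounded length. -/
theorem exists_pre_boundaryMap (φ : FreeGroup α ≃* FreeGroup α) :
    ∃ B, ∀ (X : Boundary α) (n : ℕ), (boundaryMap φ X).pre ((φ (mk (X.pre n))).norm - B) =
      (φ (mk (X.pre n))).toWord.take ((φ (mk (X.pre n))).norm - B) := by
  obtain ⟨B, hB⟩ := exists_bounded_cancellation φ
  refine ⟨B, fun X n => ?_⟩
  obtain ⟨N, hN, hnN⟩ := ((boundaryMap_spec φ X ((φ (mk (X.pre n))).norm - B)).and
    (eventually_ge_atTop n)).exists
  have h1 : X.pre n ++ (X.pre N).drop n = X.pre N := by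
    rw [← X.pre_take hnN, List.take_append_drop]
  have h2 := hB (X.pre n) ((X.pre N).drop n) (by rw [h1]; exact X.pre_isReduced N)
  rw [h1] at h2
  rw [← hN, (le_gromovProduct_iff.1 (Nat.sub_le_of_le_add h2)).2.2]

/-! ### Attracting fixed points -/

/-- If `φ` has no nontrivial fixed element, then along a fixed boundary point `X` the lengths
`|φ X_n| - n` tend to infinity in absolute value, with constant sign: the elements
`X_n⁻¹ * φ X_n` are distinct, so only finitely many of them lie in a given ball. -/
theorem norm_map_pre_dichotomy {φ : FreeGroup α ≃* FreeGroup α} (hφ : ∀ g, φ g = g → g = 1)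
    {X : Boundary α} (hX : boundaryMap φ X = X) (R : ℕ) :
    (∃ N, ∀ n ≥ N, n + R < (φ (mk (X.pre n))).norm) ∨
      ∃ N, ∀ n ≥ N, (φ (mk (X.pre n))).norm + R < n := by
  obtain ⟨B, hB⟩ := exists_pre_boundaryMap φ
  obtain ⟨C, hC⟩ := exists_norm_map_le φ.toMonoidHom
  replace hC : ∀ g, (φ g).norm ≤ C * g.norm := hC
  set l : ℕ → ℕ := fun n => (φ (mk (X.pre n))).norm with hl
  have hpn : ∀ n, (mk (X.pre n)).norm = n := fun n => by
    rw [(X.pre_isReduced n).norm_mk, X.pre_length]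
  have hinj : Function.Injective fun n => (mk (X.pre n))⁻¹ * φ (mk (X.pre n)) := by
    intro i j hij
    have h1 := hφ (mk (X.pre j) * (mk (X.pre i))⁻¹) (by
      have h2 : φ (mk (X.pre j)) = mk (X.pre j) * ((mk (X.pre i))⁻¹ * φ (mk (X.pre i))) := by
        rw [show (mk (X.pre i))⁻¹ * φ (mk (X.pre i)) = _ from hij, mul_inv_cancel_left]
      rw [_root_.map_mul, _root_.map_inv, h2]
      group)
    have h2 := congrArg norm (mul_inv_eq_one.1 h1)
    rwa [hpn, hpn, eq_comm] at h2
  have hball : ∀ R, {g : FreeGroup α | g.norm ≤ R}.Finite := fun R =>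
    ((List.finite_length_le (α × Bool) R).preimage toWord_injective.injOn)
  have hfin : ∀ R, {n | n ≤ l n + R ∧ l n ≤ n + R}.Finite := by
    intro R
    refine ((hball (R + 2 * B)).preimage hinj.injOn).subset fun n hn => ?_
    have h1 := norm_inv_mul_add (mk (X.pre n)) (φ (mk (X.pre n)))
    have h2 : min n (l n - B) ≤ gromovProduct (mk (X.pre n)) (φ (mk (X.pre n))) := by
      have h3 : l n - B ≤ l n := Nat.sub_le _ _
      refine le_gromovProduct_iff.2 ⟨by rw [hpn]; omega, by change _ ≤ l n; omega, ?_⟩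
      have h4 := congrArg (List.take n) (hB X n)
      rw [hX, List.take_take] at h4
      change _ = List.take (min n (l n - B)) _ at h4
      rw [mk_pre_toWord, X.pre_take (min_le_left _ _), ← h4]
      change X.pre (min n (l n - B)) = (X.pre (l n - B)).take n
      rcases le_total n (l n - B) with h5 | h5
      · rw [X.pre_take h5, min_eq_left h5]
      · rw [List.take_of_length_le (by rwa [X.pre_length]), min_eq_right h5]
    rw [hpn] at h1
    change _ + _ = n + l n at h1
    change ((mk (X.pre n))⁻¹ * φ (mk (X.pre n))).norm ≤ R + 2 * B
    obtain ⟨h5, h6⟩ := hn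
    omega
  have hstep : ∀ n, l (n + 1) ≤ l n + C ∧ l n ≤ l (n + 1) + C := by
    intro n
    have h1 : φ (mk (X.pre (n + 1))) = φ (mk (X.pre n)) * φ (mk [X.letter n]) := by
      rw [← _root_.map_mul, mul_mk]
      simp [Boundary.pre, List.range_succ]
    have h2 : (φ (mk [X.letter n])).norm ≤ C := by
      refine (hC _).trans ?_
      have := Nat.mul_le_mul_left C (norm_mk_le (L₁ := [X.letter n]))
      simpa using this
    have h3 := norm_mul_le (φ (mk (X.pre n))) (φ (mk [X.letter n]))
    have h4 := norm_mul_le (φ (mk (X.pre (n + 1)))) (φ (mk [X.letter n]))⁻¹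
    rw [← h1] at h3
    rw [norm_inv_eq, h1, mul_inv_cancel_right, ← h1] at h4
    simp only [hl]
    omega
  obtain ⟨N, hN⟩ := (hfin (R + C)).bddAbove
  have hN' : ∀ n > N, n + (R + C) < l n ∨ l n + (R + C) < n := by
    intro n hn
    by_contra! h
    have := hN (show n ∈ {n | n ≤ l n + (R + C) ∧ l n ≤ n + (R + C)} from ⟨h.2, h.1⟩)
    omega
  -- The sign is constant because the lengths of consecutive terms differ by at most `C`.
  rcases hN' (N + 1) (by omega) with h | h
  · refine .inl ⟨N + 1, fun n hn => ?_⟩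
    suffices n + (R + C) < l n by change n + R < l n; omega
    induction n, hn using Nat.le_induction with
    | base => exact h
    | succ n hn ih =>
      have := hstep n
      have := hN' (n + 1) (by omega)
      omega
  · refine .inr ⟨N + 1, fun n hn => ?_⟩
    suffices l n + (R + C) < n by change l n + R < n; omega
    induction n, hn using Nat.le_induction with
    | base => exact h
    | succ n hn ih =>
      have := hstep n
      have := hN' (n + 1) (by omega)
      omega

/-- A fixed point `X` of the boundary map of `φ` is attracting: the small cylinders around `X` are
mapped into smaller ones. -/
def IsAttracting (φ : FreeGroup α ≃* FreeGroup α) (X : Boundary α) : Prop :=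
  ∃ N, ∀ n ≥ N, ∀ Z : Boundary α, Z.pre n = X.pre n →
    (boundaryMap φ Z).pre (n + 1) = X.pre (n + 1)

/-- If `φ` has no nontrivial fixed element, then each fixed boundary point is attracting or
repelling. -/
theorem isAttracting_or_isAttracting_symm {φ : FreeGroup α ≃* FreeGroup α}
    (hφ : ∀ g, φ g = g → g = 1) {X : Boundary α} (hX : boundaryMap φ X = X) :
    IsAttracting φ X ∨ IsAttracting φ.symm X := by
  have hatt : ∀ {φ : FreeGroup α ≃* FreeGroup α}, boundaryMap φ X = X →
      (∀ R, ∃ N, ∀ n ≥ N, n + R < (φ (mk (X.pre n))).norm) → IsAttracting φ X := by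
    intro φ hX h
    obtain ⟨B, hB⟩ := exists_pre_boundaryMap φ
    obtain ⟨N, hN⟩ := h B
    refine ⟨N, fun n hn Z hZ => ?_⟩
    have h1 := hB Z n
    rw [hZ, ← hB X n, hX] at h1
    have h2 := congrArg (List.take (n + 1)) h1
    have h3 := hN n hn
    rwa [Boundary.pre_take _ (by omega), Boundary.pre_take _ (by omega)] at h2
  have hX' : boundaryMap φ.symm X = X := by
    conv_lhs => rw [← hX]
    exact boundaryMap_symm_apply φ X
  have hφ' : ∀ g, φ.symm g = g → g = 1 := fun g hg => hφ g (φ.symm_apply_eq.1 hg).symm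
  by_cases h1 : ∀ R, ∃ N, ∀ n ≥ N, n + R < (φ (mk (X.pre n))).norm
  · exact .inl (hatt hX h1)
  refine .inr (hatt hX' fun R' => ?_)
  refine (norm_map_pre_dichotomy hφ' hX' R').resolve_right ?_
  rintro ⟨N', hN'⟩
  -- Now both `φ` and its inverse shorten the long prefixes of `X`, which is absurd.
  obtain ⟨R₀, hR₀⟩ := not_forall.1 h1
  obtain ⟨B, hB⟩ := exists_pre_boundaryMap φ
  obtain ⟨D, hD⟩ := exists_norm_map_le φ.symm.toMonoidHom
  replace hD : ∀ g, (φ.symm g).norm ≤ D * g.norm := hD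
  obtain ⟨N, hN⟩ := (norm_map_pre_dichotomy hφ hX (R₀ + D * B)).resolve_left fun ⟨N, hN⟩ =>
    hR₀ ⟨N, fun n hn => by have := hN n hn; omega⟩
  set n := max N (D * (N' + B) + 1) with hn
  have h2 := hN n (le_max_left _ _)
  have hpn : (mk (X.pre n)).norm = n := by rw [(X.pre_isReduced n).norm_mk, X.pre_length]
  have h3 := hD (φ (mk (X.pre n)))
  rw [φ.symm_apply_apply, hpn] at h3
  set l := (φ (mk (X.pre n))).norm with hl
  have h4 : N' + B < l := by
    by_contra! hle
    have := Nat.mul_le_mul_left D hle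
    have := le_max_right N (D * (N' + B) + 1)
    omega
  have h5 := hB X n
  rw [hX, ← hl] at h5
  have h6 : φ (mk (X.pre n)) =
      mk (X.pre (l - B)) * mk ((φ (mk (X.pre n))).toWord.drop (l - B)) := by
    rw [h5, mul_mk, List.take_append_drop, mk_toWord]
  have h7 := congrArg φ.symm h6
  rw [φ.symm_apply_apply, _root_.map_mul] at h7
  have h8 := congrArg norm h7
  rw [hpn] at h8
  have h9 := norm_mul_le (φ.symm (mk (X.pre (l - B))))
    (φ.symm (mk ((φ (mk (X.pre n))).toWord.drop (l - B))))
  have h10 := hD (mk ((φ (mk (X.pre n))).toWord.drop (l - B)))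
  have h11 : (mk ((φ (mk (X.pre n))).toWord.drop (l - B))).norm ≤ B := by
    refine norm_mk_le.trans ?_
    rw [List.length_drop]
    change l - (l - B) ≤ B
    omega
  have h12 := Nat.mul_le_mul_left D h11
  have h13 := hN' (l - B) (by omega)
  omega

end

/-! ### Limits of powers -/

section

variable {α : Type*}

theorem isCyclicallyReduced_invRev {w : List (α × Bool)} (hw : IsCyclicallyReduced w) :
    IsCyclicallyReduced (invRev w) := by
  refine ⟨isReduced_invRev hw.1, fun a ha b hb => ?_⟩
  rw [getLast?_invRev] at ha
  rw [head?_invRev] at hb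
  obtain ⟨c, hc, rfl⟩ := Option.mem_map.1 ha
  obtain ⟨d, hd, rfl⟩ := Option.mem_map.1 hb
  rw [← ne_invLetter_iff, invLetter_invLetter, Ne, eq_comm]
  exact ne_invLetter_iff.2 (hw.2 d hd c hc)

theorem getElem?_flatten_replicate (w : List (α × Bool)) {i n : ℕ} (hi : i < n)
    (hw : w ≠ []) : (List.replicate n w).flatten[i]? = w[i % w.length]? := by
  have h0 := List.length_pos_of_ne_nil hw
  induction n generalizing i with
  | zero => omega
  | succ n ih =>
    rw [List.replicate_succ, List.flatten_cons, List.getElem?_append]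
    split_ifs with h
    · rw [Nat.mod_eq_of_lt h]
    · rw [ih (by omega), Nat.mod_eq_sub_mod (not_lt.1 h)]

variable [DecidableEq α]

/-- The powers of a cyclically reduced word converge to an infinite periodic word. -/
theorem exists_tendstoBoundary_mk_pow {w : List (α × Bool)} (hw : IsCyclicallyReduced w)
    {c : α × Bool} (hc : w.head? = some c) :
    ∃ Z : Boundary α, TendstoBoundary (fun n => mk w ^ n) Z ∧ Z.letter 0 = c := by
  have hne : w ≠ [] := by rintro rfl; simp at hc
  have h0 := List.length_pos_of_ne_nil hne
  have hword : ∀ n, (mk w ^ n).toWord = (List.replicate n w).flatten := fun n => by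
    rw [pow_mk, toWord_mk, (hw.flatten_replicate n).isReduced.reduce_eq]
  have hget : ∀ i n, i < n →
      (mk w ^ n).toWord[i]? = some (w[i % w.length]'(Nat.mod_lt _ h0)) := fun i n hi => by
    rw [hword, getElem?_flatten_replicate w hi hne, List.getElem?_eq_getElem]
  refine ⟨⟨fun i => w[i % w.length]'(Nat.mod_lt _ h0), fun i => ?_⟩, fun m => ?_, ?_⟩
  · have h1 : IsReduced (mk w ^ (i + 2)).toWord := isReduced_toWord
    unfold IsReduced at h1
    rw [List.isChain_iff_getElem] at h1
    have e1 := hget i (i + 2) (by omega)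
    have e2 := hget (i + 1) (i + 2) (by omega)
    obtain ⟨hi1, e1⟩ := List.getElem?_eq_some_iff.1 e1
    obtain ⟨hi2, e2⟩ := List.getElem?_eq_some_iff.1 e2
    have h2 := h1 i hi2
    rwa [e1, e2] at h2
  · filter_upwards [eventually_ge_atTop m] with n hn
    apply List.ext_getElem?
    intro i
    rw [List.getElem?_take]
    split_ifs with hi
    · rw [hget i n (by omega), Boundary.pre_getElem? _ hi]
    · rw [List.getElem?_eq_none]
      rw [Boundary.pre_length]
      omega
  · cases w with
    | nil => simp at hc
    | cons d w => simpa using hc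

variable [Finite α]

theorem exists_tendstoBoundary_pow {g : FreeGroup α} (hg : g ≠ 1) :
    ∃ Z Z' : Boundary α, Z ≠ Z' ∧ TendstoBoundary (fun n => g ^ n) Z ∧
      TendstoBoundary (fun n => g⁻¹ ^ n) Z' := by
  set w := reduceCyclically g.toWord with hw
  set p := mk (reduceCyclically.conjugator g.toWord) with hp
  have hwr : IsCyclicallyReduced w := reduceCyclically.isCyclicallyReduced isReduced_toWord
  have hgw : g = p * mk w * p⁻¹ := by
    rw [hp, hw, inv_mk, mul_mk, mul_mk, reduceCyclically.conj_conjugator_reduceCyclically,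
      mk_toWord]
  have hne : w ≠ [] := by
    intro h
    rw [h, ← one_eq_mk] at hgw
    exact hg (by simpa using hgw)
  obtain ⟨c, hc⟩ := Option.ne_none_iff_exists'.1 (mt List.head?_eq_none_iff.1 hne)
  obtain ⟨d, hd⟩ := Option.ne_none_iff_exists'.1 (mt List.getLast?_eq_none_iff.1 hne)
  obtain ⟨Z, hZ, hZ0⟩ := exists_tendstoBoundary_mk_pow hwr hc
  obtain ⟨Z', hZ', hZ0'⟩ := exists_tendstoBoundary_mk_pow (isCyclicallyReduced_invRev hwr)
    (c := invLetter d) (by rw [head?_invRev, hd]; rfl)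
  refine ⟨boundaryMap (MulAut.conj p) Z, boundaryMap (MulAut.conj p) Z',
    (boundaryMap_injective _).ne ?_, ?_, ?_⟩
  · intro h
    rw [h, hZ0'] at hZ0
    exact ne_invLetter_iff.2 (hwr.2 d hd c hc) hZ0.symm
  · convert hZ.map (MulAut.conj p) using 2 with n
    rw [MulAut.conj_apply, ← conj_pow, ← hgw]
  · convert hZ'.map (MulAut.conj p) using 2 with n
    rw [MulAut.conj_apply, ← conj_pow, ← inv_mk, hgw]
    group

/-- An automorphism that fixes a nontrivial element fixes two points of the boundary, so one that
is different from a given point. -/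
theorem exists_boundaryMap_eq_self {φ : FreeGroup α ≃* FreeGroup α} {g : FreeGroup α} (hg : g ≠ 1)
    (hφ : φ g = g) (X : Boundary α) : ∃ Z, Z ≠ X ∧ boundaryMap φ Z = Z := by
  obtain ⟨Z, Z', hne, hZ, hZ'⟩ := exists_tendstoBoundary_pow hg
  have h1 : boundaryMap φ Z = Z := by
    have := hZ.map φ
    simp only [_root_.map_pow, hφ] at this
    exact this.unique hZ
  have h2 : boundaryMap φ Z' = Z' := by
    have := hZ'.map φ
    simp only [_root_.map_pow, _root_.map_inv, hφ] at this
    exact this.unique hZ'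
  by_cases h : Z = X
  · exact ⟨Z', fun h' => hne (h.trans h'.symm), h2⟩
  · exact ⟨Z, h, h1⟩

/-! ### Parabolic orbits -/

/-- An orbit that comes from an attracting fixed point is constant. -/
theorem IsAttracting.eq_of_tendsto {φ : FreeGroup α ≃* FreeGroup α} {X : Boundary α}
    (h : IsAttracting φ X) {y : ℤ → Boundary α} (hy : ∀ k, y (k + 1) = boundaryMap φ (y k))
    (hlim : Tendsto y atBot (𝓝 X)) : y 0 = X := by
  obtain ⟨N, hN⟩ := h
  refine Boundary.ext_pre fun m => ?_
  obtain ⟨k, hk, hk0⟩ := ((Boundary.eventually_pre_eq hlim (max m N)).and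
    (eventually_le_atBot 0)).exists
  have h1 : ∀ j : ℕ, (y (k + j)).pre (max m N) = X.pre (max m N) := by
    intro j
    induction j with
    | zero => simpa using hk
    | succ j ih =>
      rw [Nat.cast_succ, ← add_assoc, hy]
      have h2 := congrArg (List.take (max m N)) (hN _ (le_max_right m N) _ ih)
      rwa [Boundary.pre_take _ (Nat.le_succ _), Boundary.pre_take _ (Nat.le_succ _)] at h2
  have h2 := congrArg (List.take m) (h1 (-k).toNat)
  rwa [Boundary.pre_take _ (le_max_left _ _), Boundary.pre_take _ (le_max_left _ _),
    show k + ((-k).toNat : ℤ) = 0 by omega] at h2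

end

/-- In the linear order on the complement of the fixed point `X`, an orbit that moves towards a
second fixed point `Z` does not converge to `X`. -/
theorem PreservesCyc.not_tendsto {ψ : MulAut (FreeGroup (Fin 2))} (hψ : PreservesCyc ψ)
    {X Z : Boundary (Fin 2)} (hX : boundaryMap ψ X = X) (hZ : boundaryMap ψ Z = Z)
    {y : ℕ → Boundary (Fin 2)} (hy : ∀ k, y (k + 1) = boundaryMap ψ (y k))
    (h : (BoundaryCyc X (y 0) (y 1) ∧ BoundaryCyc X (y 0) Z) ∨
      (BoundaryCyc X (y 1) (y 0) ∧ BoundaryCyc X Z (y 0))) : ¬ Tendsto y atTop (𝓝 X) := by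
  intro hlim
  rcases h with ⟨h1, h2⟩ | ⟨h1, h2⟩
  · have h3 : ∀ k, BoundaryCyc X (y k) (y (k + 1)) ∧ BoundaryCyc X (y k) Z := by
      intro k
      induction k with
      | zero => exact ⟨h1, h2⟩
      | succ k ih =>
        have i1 := hψ _ _ _ ih.1
        have i2 := hψ _ _ _ ih.2
        rw [hX, ← hy, ← hy] at i1
        rw [hX, hZ, ← hy] at i2
        exact ⟨i1, i2⟩
    have h4 : ∀ k, BoundaryCyc X (y 0) (y (k + 1)) := by
      intro k
      induction k with
      | zero => exact h1
      | succ k ih => exact ih.trans (h3 (k + 1)).1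
    obtain ⟨k, hk⟩ := ((tendsto_add_atTop_iff_nat 1).2 hlim
      |>.eventually (eventually_not_boundaryCyc h2)).exists
    exact hk ⟨h4 k, (h3 _).2⟩
  · have h3 : ∀ k, BoundaryCyc X (y (k + 1)) (y k) ∧ BoundaryCyc X Z (y k) := by
      intro k
      induction k with
      | zero => exact ⟨h1, h2⟩
      | succ k ih =>
        have i1 := hψ _ _ _ ih.1
        have i2 := hψ _ _ _ ih.2
        rw [hX, ← hy, ← hy] at i1
        rw [hX, hZ, ← hy] at i2
        exact ⟨i1, i2⟩
    have h4 : ∀ k, BoundaryCyc X (y (k + 1)) (y 0) := by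
      intro k
      induction k with
      | zero => exact h1
      | succ k ih => exact (h3 (k + 1)).1.trans ih
    obtain ⟨k, hk⟩ := ((tendsto_add_atTop_iff_nat 1).2 hlim
      |>.eventually (eventually_not_boundaryCyc h2)).exists
    exact hk ⟨(h3 _).2, h4 k⟩

/-- An automorphism that preserves the cyclic order has no parabolic orbit. -/
theorem PreservesCyc.eq_of_tendsto {ψ : MulAut (FreeGroup (Fin 2))} (hψ : PreservesCyc ψ)
    {X : Boundary (Fin 2)} {y : ℤ → Boundary (Fin 2)}
    (hy : ∀ k, y (k + 1) = boundaryMap ψ (y k)) (hpos : Tendsto y atTop (𝓝 X))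
    (hneg : Tendsto y atBot (𝓝 X)) : y 0 = X := by
  have hX : boundaryMap ψ X = X := by
    have h1 := ((continuous_boundaryMap ψ).tendsto X).comp hpos
    have h2 := hpos.comp (tendsto_atTop_add_const_right atTop (1 : ℤ) tendsto_id)
    refine Boundary.ext_pre fun m => ?_
    obtain ⟨k, hk1, hk2⟩ := ((Boundary.eventually_pre_eq h1 m).and
      (Boundary.eventually_pre_eq h2 m)).exists
    rw [← hk1, ← hk2]
    simp [hy]
  have hy' : ∀ k, y (k - 1) = boundaryMap ψ⁻¹ (y k) := by
    intro k
    have h1 := hy (k - 1)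
    rw [sub_add_cancel] at h1
    rw [h1]
    exact (boundaryMap_symm_apply ψ _).symm
  have hsymm : ∀ {Z}, boundaryMap ψ Z = Z → boundaryMap ψ⁻¹ Z = Z := fun {Z} hZ => by
    conv_lhs => rw [← hZ]
    exact boundaryMap_symm_apply ψ Z
  have hrev : Tendsto (fun k => y (-k)) atBot (𝓝 X) := hpos.comp tendsto_neg_atBot_atTop
  by_cases hfix : ∀ g, ψ g = g → g = 1
  · rcases isAttracting_or_isAttracting_symm hfix hX with h | h
    · exact h.eq_of_tendsto hy hneg
    · have := h.eq_of_tendsto (y := fun k => y (-k)) (fun k => by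
        rw [neg_add, ← sub_eq_add_neg]; exact hy' _) hrev
      simpa using this
  push Not at hfix
  obtain ⟨g, hg, hg1⟩ := hfix
  obtain ⟨Z, hZX, hZ⟩ := exists_boundaryMap_eq_self hg1 hg X
  by_contra hne
  have hconst : ∀ {W}, boundaryMap ψ W = W → y 0 = W → W = X := by
    intro W hW h0
    have h1 : ∀ k : ℕ, y k = W := by
      intro k
      induction k with
      | zero => exact h0
      | succ k ih => rw [Nat.cast_succ, hy, ih, hW]
    refine Boundary.ext_pre fun m => ?_
    obtain ⟨k, hk⟩ := (tendsto_natCast_atTop_atTop.eventually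
      (Boundary.eventually_pre_eq hpos m)).exists
    rw [← hk, h1]
  have h0Z : y 0 ≠ Z := fun h => hZX (hconst hZ h)
  have h01 : y 0 ≠ y 1 := fun h => hne (hconst (by rw [← hy]; exact h.symm) rfl)
  have h1X : y 1 ≠ X := fun h => hne (boundaryMap_injective ψ (by
    rw [hX, ← h, ← hy]; rfl))
  have hfwd := hψ.not_tendsto hX hZ (y := fun k : ℕ => y k) (fun k => by
    rw [Nat.cast_succ, hy])
  have hbwd := hψ.inv.not_tendsto (hsymm hX) (hsymm hZ) (y := fun k : ℕ => y (-k)) (fun k => by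
    rw [Nat.cast_succ, neg_add, ← sub_eq_add_neg, hy'])
  simp only [Nat.cast_zero, Nat.cast_one, neg_zero] at hfwd hbwd
  replace hfwd := mt hfwd (not_not.2 (hpos.comp tendsto_natCast_atTop_atTop))
  replace hbwd := mt hbwd (not_not.2 (hneg.comp
    (tendsto_neg_atTop_atBot.comp tendsto_natCast_atTop_atTop)))
  have hback : ∀ {A B}, BoundaryCyc X A B →
      BoundaryCyc X (boundaryMap ψ⁻¹ A) (boundaryMap ψ⁻¹ B) := by
    intro A B h
    have := hψ.inv _ _ _ h
    rwa [hsymm hX] at this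
  have e0 : boundaryMap ψ⁻¹ (y 0) = y (-1) := (hy' 0).symm
  have e1 : boundaryMap ψ⁻¹ (y 1) = y 0 := (hy' 1).symm
  rcases boundaryCyc_or (Ne.symm hne) h1X.symm h01 with h1 | h1 <;>
    rcases boundaryCyc_or (Ne.symm hne) hZX.symm h0Z with h2 | h2
  · exact hfwd (.inl ⟨h1, h2⟩)
  · refine hbwd (.inr ⟨?_, h2⟩)
    have := hback h1
    rwa [e0, e1] at this
  · refine hbwd (.inl ⟨?_, h2⟩)
    have := hback h1
    rwa [e0, e1] at this
  · exact hfwd (.inr ⟨h1, h2⟩)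

end FreeGroup

/-- No automorphism of the free group of rank two has a parabolic orbit in its boundary. -/
theorem proposition1 :
    ¬ ∃ φ : FreeGroup (Fin 2) ≃* FreeGroup (Fin 2), FreeGroup.HasParabolicOrbit φ := by
  rintro ⟨φ, X, Y, hXY, hpos, hneg⟩
  have hsq : FreeGroup.PreservesCyc ((φ : MulAut (FreeGroup (Fin 2))) * φ) :=
    (FreeGroup.preservesCyc_or_reversesCyc φ).elim (fun h => h.mul h) fun h => h.mul h
  refine hXY (hsq.eq_of_tendsto
    (y := fun k => (FreeGroup.boundaryHomeomorph φ ^ (2 * k)) Y) (fun k => ?_) ?_ ?_).symm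
  · rw [FreeGroup.boundaryMap_mul, mul_add, mul_one, add_comm, zpow_add]
    rfl
  · exact hpos.comp (tendsto_atTop_atTop.2 fun b => ⟨max b 0, fun a ha => by omega⟩)
  · exact hneg.comp (tendsto_atBot_atBot.2 fun b => ⟨min b 0, fun a ha => by omega⟩)
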